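/- Let $d\ge 1$, $K=\lfloor d/2\rfloor+1$ and $\mathbb T^d=(\mathbb R/2\pi\mathbb Z)^d$. For a continuous function $f$ on $\mathbb T^d$ put $c_n(f)=\int_{[0,2\pi]^d} f(\theta)\,\mathrm e^{-\mathrm i\langle n,\theta\rangle}\frac{d\theta}{(2\pi)^d}$ ($n\in\mathbb Z^d$) and $\|f\|_{\mathscr A}=\sum_{n\in\mathbb Z^d}|c_n(f)|$; the Wiener algebra $\mathscr A$ is the set of such $f$ with $\|f\|_{\mathscr A}<\infty$. For a signed measure $\mu$ on $\mathbb Z^d$ put $\widehat\mu(\xi)=\sum_{k\in\mathbb Z^d}\mu(\{k\})\,\mathrm e^{\mathrm i\langle k,\xi\rangle}$. For $i=1,\dots,d$ let $\phi_i$ be the Lévy–Khintchine exponent of an infinitely divisible probability measure $\rho_i$ on $\mathbb Z$ (that is, $\phi_i$ is continuous and $2\pi$-periodic, $\phi_i(0)=0$, $\widehat{\rho_i}=\mathrm e^{\phi_i}$, and $\mathrm e^{\phi_i/n}$ is the Fourier transform of a probability measure on $\mathbb Z$ for every $n\ge1$). Assume that $\rho_i$ is not supported on any proper subgroup of $\mathbb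 Z$ and has finite moments up to order $\max(2,K)$. Write $\phi(\xi)=\sum_{i=1}^d\phi_i(\xi_i)$, let $\phi_i(\theta)=\mathrm i m_i\theta-\frac{\sigma_i^2\theta^2}{2}+o(\theta^2)$ be the Taylor expansion at $0$, and set $$\gamma(\varepsilon)=\sup_{i}\sup_{|\theta|\le\varepsilon}|\phi_i''(\theta)+\sigma_i^2|,\qquad M=-\sup_{i}\sup_{0<|\theta|\le\pi}\frac{\Re\phi_i(\theta)}{\theta^2}.$$ For an integer $r\ge\lfloor d/2\rfloor$ and a real $\lambda>0$ consider signed measures $\mu,\nu$ on $\mathbb Z^d$ with $$\widehat\mu=\mathrm e^{\lambda\phi}\psi,\qquad \widehat\nu=\mathrm e^{\lambda\phi}\chi,$$ where $\psi,\chi:\mathbb T^d\to\mathbb C$ are of class $\mathscr C^{r+1}$ and $\partial^\alpha(\psi-\chi)(0)=0$ for all multi-indices $|\alpha|\le r$. Set $\beta_{r+1}(\varepsilon)=\sup_{|\alpha|=r+1}\sup_{\xi\in[-\varepsilon,\varepsilon]^d}|\partial^\alpha(\psi-\chi)(\xi)|$. Then $\psi-\chi$ and $\widehat\mu-\widehat\nu$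 belong to $\mathscr A$, and the following hold. (1) For every $\lambda_0>0$ there are positive constants $C_1,C_2$, depending only on $d$, $\phi$ and $\lambda_0$, such that for all $r\ge\lfloor d/2\rfloor$, all $\lambda\ge\lambda_0$, all $\mu,\nu,\psi,\chi$ as above and all $\varepsilon\in(0,1)$ with $\gamma(\varepsilon)\le\min_i\frac{\sigma_i^2}{2}$, $$\|\widehat\mu-\widehat\nu\|_{\mathscr A}\le C_1\left(\|\psi-\chi\|_{\mathscr A}\,\frac{\lambda^K\mathrm e^{-\lambda M\varepsilon^2/4}}{\varepsilon}+\frac{\varepsilon^{r+1}\beta_{r+1}(\varepsilon)}{\lambda^{d/4}}\left(\sqrt\lambda+\frac1\varepsilon\right)^{K}\right)\left(1+\frac{C_2}{\sqrt\lambda}\right).$$ (2) For every $r\ge\lfloor d/2\rfloor$ there is a constant $C_3>0$, depending only on $r$, $d$ and $\phi$, such that for every $\varepsilon>0$ there is $\lambda_1\ge 2$ (depending only on $\varepsilon,r,d,\phi$) such that for all $\lambda\ge\lambda_1$ and all $\mu,\nu,\psi,\chi$ as above, $$\|\widehat\mu-\widehat\nu\|_{\mathscr A}\le C_3\left(\|\psi-\chi\|_{\mathscr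 A}+\beta_{r+1}(\varepsilon)\right)\frac{(\log\lambda)^{r+1}}{\lambda^{\frac r2+\frac14}}.$$ -/

import Mathlib

open MeasureTheory

noncomputable section

namespace MultiWiener

/-- `K_d = ⌊d/2⌋ + 1`. -/
def K (d : ℕ) : ℕ := d / 2 + 1

/-- `f` is `2π`-periodic in each coordinate. Functions on the torus `(ℝ / 2πℤ)^d` are represented by
such functions on `ℝ^d`. -/
def TorusPeriodic {d : ℕ} (f : (Fin d → ℝ) → ℂ) : Prop :=
  ∀ (ξ : Fin d → ℝ) (i : Fin d), f (ξ + Pi.single i (2 * Real.pi)) = f ξ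

/-- The Fourier coefficient `c_n(f) = ∫_{[0,2π]^d} f(θ) exp(-i ⟨n,θ⟩) dθ / (2π)^d`. -/
def fourierCoeff {d : ℕ} (f : (Fin d → ℝ) → ℂ) (n : Fin d → ℤ) : ℂ :=
  (1 / (2 * (Real.pi : ℂ)) ^ d) *
    ∫ θ in Set.Icc (0 : Fin d → ℝ) (fun _ => 2 * Real.pi),
      f θ * Complex.exp (-(Complex.I * ∑ j, (n j : ℂ) * (θ j : ℂ)))

/-- Membership in the Wiener algebra `𝒜(𝕋^d)`. -/
structure MemWiener {d : ℕ} (f : (Fin d → ℝ) → ℂ) : Prop where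
  periodic : TorusPeriodic f
  continuous : Continuous f
  summable : Summable fun n : Fin d → ℤ => ‖fourierCoeff f n‖

/-- The Wiener norm `‖f‖_𝒜 = ∑_{n ∈ ℤ^d} |c_n(f)|`. -/
def wienerNorm {d : ℕ} (f : (Fin d → ℝ) → ℂ) : ℝ :=
  ∑' n : Fin d → ℤ, ‖fourierCoeff f n‖

/-- The Fourier transform `∑_k μ({k}) exp(i ⟨k,ξ⟩)` of a signed measure on `ℤ^d`. -/
def fourier {d : ℕ} (μ : SignedMeasure (Fin d → ℤ)) (ξ : Fin d → ℝ) : ℂ :=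
  ∑' k : Fin d → ℤ, ((μ {k} : ℝ) : ℂ) *
    Complex.exp (Complex.I * ∑ j, (k j : ℂ) * (ξ j : ℂ))

/-- The Fourier transform `∑_k ρ({k}) exp(i k θ)` of a measure on `ℤ`. -/
def fourierInt (ρ : Measure ℤ) (θ : ℝ) : ℂ :=
  ∫ k : ℤ, Complex.exp (Complex.I * (k : ℂ) * (θ : ℂ)) ∂ρ

/-- The probability measure `ρ` on `ℤ` is infinitely divisible with Lévy–Khintchine exponent `φ`:
`φ` is continuous and `2π`-periodic with `φ(0) = 0`, `exp φ` is the Fourier transform of `ρ`, and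
for every `n ≥ 1`, `exp (φ / n)` is the Fourier transform of a probability measure on `ℤ` (whose
`n`-th convolution power is then `ρ`). -/
structure IsLevyExponent (ρ : Measure ℤ) (φ : ℝ → ℂ) : Prop where
  continuous : Continuous φ
  periodic : Function.Periodic φ (2 * Real.pi)
  zero : φ 0 = 0
  fourier_eq : ∀ θ : ℝ, fourierInt ρ θ = Complex.exp (φ θ)
  divisible : ∀ n : ℕ, 1 ≤ n → ∃ ρn : Measure ℤ, IsProbabilityMeasure ρn ∧
    ∀ θ : ℝ, fourierInt ρn θ = Complex.exp (φ θ / (n : ℂ))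

/-- No proper sublattice (subgroup) of `ℤ` carries `ρ`. -/
def HasMinimalLattice (ρ : Measure ℤ) : Prop :=
  ∀ H : AddSubgroup ℤ, ρ ((H : Set ℤ)ᶜ) = 0 → H = ⊤

/-- `ρ` has a finite absolute moment of order `p`. -/
def HasMoment (p : ℕ) (ρ : Measure ℤ) : Prop :=
  Integrable (fun k : ℤ => |(k : ℝ)| ^ p) ρ

/-- The exponent `φ(ξ) = ∑_i φ_i(ξ_i)`. -/
def sumExponent {d : ℕ} (φ : Fin d → ℝ → ℂ) (ξ : Fin d → ℝ) : ℂ :=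
  ∑ i, φ i (ξ i)

/-- The coefficient `σ²` of the expansion `φ(θ) = i m θ - σ² θ² / 2 + o(θ²)` of an exponent of
class `𝒞²`, that is, `-φ''(0)`, which is real for a Lévy–Khintchine exponent. -/
def sigmaSq (φ : ℝ → ℂ) : ℝ :=
  -(iteratedDeriv 2 φ 0).re

/-- The partial derivative `∂_{s_1} ⋯ ∂_{s_n} f (ξ)`. For `f` of class `𝒞^n`, these are exactly the
derivatives `∂^α f (ξ)` with `|α| = n`, where `α_i` is the number of occurrences of `i` in `s`. -/
def partialDeriv {d n : ℕ} (s : Fin n → Fin d) (f : (Fin d → ℝ) → ℂ) (ξ : Fin d → ℝ) : ℂ :=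
  iteratedFDeriv ℝ n f ξ fun j => Pi.single (s j) 1

/-- For `f = ψ - χ` and `n = r + 1`, this is `β_{r+1}(ε)`: the supremum over `|α| = n` and
`ξ ∈ [-ε,ε]^d` of `|∂^α f (ξ)|`. -/
def betaSup {d : ℕ} (n : ℕ) (f : (Fin d → ℝ) → ℂ) (ε : ℝ) : ℝ :=
  sSup {x : ℝ | ∃ (s : Fin n → Fin d) (ξ : Fin d → ℝ),
    (∀ i, |ξ i| ≤ ε) ∧ x = ‖partialDeriv s f ξ‖}

/-- `γ(ε)`: the supremum over `i` and `θ ∈ [-ε,ε]` of `|φ_i''(θ) + σ_i²|`. -/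
def gammaSup {d : ℕ} (φ : Fin d → ℝ → ℂ) (ε : ℝ) : ℝ :=
  sSup {x : ℝ | ∃ (i : Fin d) (θ : ℝ),
    |θ| ≤ ε ∧ x = ‖iteratedDeriv 2 (φ i) θ + (sigmaSq (φ i) : ℂ)‖}

/-- `M`: minus the supremum over `i` and `θ ∈ [-π,π] \ {0}` of `Re φ_i(θ) / θ²`. -/
def decayM {d : ℕ} (φ : Fin d → ℝ → ℂ) : ℝ :=
  -sSup {x : ℝ | ∃ (i : Fin d) (θ : ℝ),
    |θ| ≤ Real.pi ∧ θ ≠ 0 ∧ x = (φ i θ).re / θ ^ 2}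

/-- The measures `μ`, `ν` have Fourier transforms `exp(lam φ) ψ` and `exp(lam φ) χ`, with residues
`ψ`, `χ` of class `𝒞^{r+1}` on the torus whose Taylor expansions at `0` agree up to order `r`. -/
structure ResidueScheme {d : ℕ} (φ : Fin d → ℝ → ℂ) (r : ℕ) (lam : ℝ)
    (μ ν : SignedMeasure (Fin d → ℤ)) (ψ χ : (Fin d → ℝ) → ℂ) : Prop where
  periodic_left : TorusPeriodic ψ
  periodic_right : TorusPeriodic χ
  contDiff_left : ContDiff ℝ ((r + 1 : ℕ) : WithTop ℕ∞) ψ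
  contDiff_right : ContDiff ℝ ((r + 1 : ℕ) : WithTop ℕ∞) χ
  fourier_left : ∀ ξ, fourier μ ξ = Complex.exp ((lam : ℂ) * sumExponent φ ξ) * ψ ξ
  fourier_right : ∀ ξ, fourier ν ξ = Complex.exp ((lam : ℂ) * sumExponent φ ξ) * χ ξ
  taylor : ∀ n : ℕ, n ≤ r → ∀ s : Fin n → Fin d, partialDeriv s (ψ - χ) 0 = 0

end MultiWiener

end

/-!
The Wiener norm of a periodic function is bounded by a Sobolev norm of order `k > d / 2`: apply
Cauchy–Schwarz against the weights `(a + ‖n‖) ^ k` and Parseval's identity. The frequency scale `a`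
is free, and it is taken to be `√λ` up to a constant, the scale on which `exp (λφ)` varies.

Multiplication by a character preserves the Wiener norm, so the linear part of the phase `λφ` at the
origin may be removed up to a bounded error. The derivatives of order `j` of the resulting
exponential are then dominated by `(√λ) ^ j` times a Gaussian `exp (-cλ|ξ|²)`, because `φ` has
bounded derivatives and `Re φ ≤ -M|ξ|²` on the period cube. The difference `h = ψ - χ` is split by a
smooth periodic cutoff at radius `ε`. Outside, the Gaussian contributes `exp (-λMε²/4)` against the
Wiener norm of `h`; inside, Taylor's formula bounds `h` by `ε ^ (r + 1) β(ε)` and the Gaussian has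
`L²` norm of order `λ ^ (-d/4)`, which the Sobolev inequality at scale `√λ` compensates. The choice
`ε = c log λ / √λ` then gives the rate.
-/

noncomputable section

namespace MultiWiener

open Filter Topology
open scoped Real

section Torus

variable {d : ℕ}

/-- Normalised Haar measure on the circle, the convention of Mathlib for Fourier series on
`UnitAddTorus`. -/
abbrev haarCircle : MeasureSpace UnitAddCircle := ⟨AddCircle.haarAddCircle⟩

attribute [local instance] haarCircle

local instance : IsProbabilityMeasure (volume : Measure UnitAddCircle) :=
  inferInstanceAs (IsProbabilityMeasure AddCircle.haarAddCircle)

/-- Invariance under the whole period lattice `2πℤ^d`, for functions with values in any type. -/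
def LatticePeriodic {α : Type*} (f : (Fin d → ℝ) → α) : Prop :=
  ∀ (ξ : Fin d → ℝ) (m : Fin d → ℤ), f (fun i => ξ i + 2 * π * m i) = f ξ

theorem LatticePeriodic.comp {α β : Type*} {f : (Fin d → ℝ) → α} (hf : LatticePeriodic f)
    (g : α → β) : LatticePeriodic fun ξ => g (f ξ) := fun ξ m => congrArg g (hf ξ m)

theorem TorusPeriodic.latticePeriodic {f : (Fin d → ℝ) → ℂ} (hf : TorusPeriodic f) :
    LatticePeriodic f := by
  intro ξ m
  have periodic_sum (s : Finset (Fin d)) : Function.Periodic f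
      (∑ i ∈ s, m i • (Pi.single i (2 * π) : Fin d → ℝ)) := by
    induction s using Finset.induction_on with
    | empty => intro x; simp
    | insert a s ha ih =>
      rw [Finset.sum_insert ha]
      exact Function.Periodic.add_period (Function.Periodic.zsmul (fun x => hf x a) _) ih
  rw [← periodic_sum Finset.univ ξ]
  congr 1
  ext i
  simp [Finset.sum_apply, Pi.single_apply, mul_comm]

theorem TorusPeriodic.mul {f g : (Fin d → ℝ) → ℂ} (hf : TorusPeriodic f) (hg : TorusPeriodic g) :
    TorusPeriodic (f * g) := fun ξ i => by simp [hf ξ i, hg ξ i]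

theorem TorusPeriodic.sub {f g : (Fin d → ℝ) → ℂ} (hf : TorusPeriodic f) (hg : TorusPeriodic g) :
    TorusPeriodic (f - g) := fun ξ i => by simp [hf ξ i, hg ξ i]

/-- The function on `(ℝ / ℤ)^d` induced by a lattice periodic function, through the rescaling
`x ↦ 2πx`. -/
def torusLift {α : Type*} (f : (Fin d → ℝ) → α) (x : UnitAddTorus (Fin d)) : α :=
  f fun i => 2 * π * (AddCircle.equivIoc 1 0 (x i) : ℝ)

theorem torusLift_coe {α : Type*} {f : (Fin d → ℝ) → α} (hf : LatticePeriodic f)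
    (y : Fin d → ℝ) :
    torusLift f (fun i => (y i : UnitAddCircle)) = f fun i => 2 * π * y i := by
  have representative (i : Fin d) :
      ∃ m : ℤ, (AddCircle.equivIoc 1 0 (y i : UnitAddCircle) : ℝ) = y i + m := by
    have hcoe : ((AddCircle.equivIoc (1 : ℝ) 0 (y i : UnitAddCircle) : ℝ) : UnitAddCircle)
        = (y i : UnitAddCircle) :=
      (AddCircle.equivIoc (1 : ℝ) 0).symm_apply_apply (y i : UnitAddCircle)
    rw [← sub_eq_zero, ← AddCircle.coe_sub, AddCircle.coe_eq_zero_iff] at hcoe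
    obtain ⟨m, hm⟩ := hcoe
    rw [zsmul_eq_mul, mul_one] at hm
    exact ⟨m, by rw [hm]; ring⟩
  choose m hm using representative
  rw [← hf (fun i => 2 * π * y i) m, torusLift]
  congr 1
  ext i
  rw [hm i]; ring

theorem continuous_torusLift {α : Type*} [TopologicalSpace α] {f : (Fin d → ℝ) → α}
    (hf : LatticePeriodic f) (hc : Continuous f) : Continuous (torusLift f) := by
  have hq : IsOpenQuotientMap (fun (y : Fin d → ℝ) (i : Fin d) => (y i : UnitAddCircle)) :=
    IsOpenQuotientMap.piMap fun _ => QuotientAddGroup.isOpenQuotientMap_mk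
  rw [hq.isQuotientMap.continuous_iff]
  have hcomp : torusLift f ∘ (fun (y : Fin d → ℝ) (i : Fin d) => (y i : UnitAddCircle)) =
      fun y => f fun i => 2 * π * y i := funext fun y => torusLift_coe hf y
  rw [hcomp]
  fun_prop

theorem integral_torusLift {E : Type*} [NormedAddCommGroup E] [NormedSpace ℝ E]
    {g : (Fin d → ℝ) → E} (hg : LatticePeriodic g) (a : ℝ) :
    ∫ x, torusLift g x = ((2 * π) ^ d)⁻¹ •
      ∫ θ in Set.Icc (fun _ : Fin d => a) (fun _ => a + 2 * π), g θ := by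
  rw [UnitAddTorus.integral_preimage _ (fun _ => a / (2 * π))]
  simp_rw [torusLift_coe hg]
  have hscale := Measure.setIntegral_comp_smul_of_pos (volume : Measure (Fin d → ℝ)) g
    {x : Fin d → ℝ | ∀ i, x i ∈ Set.Ioc (a / (2 * π)) (a / (2 * π) + 1)}
    (R := 2 * π) (by positivity)
  simp only [Module.finrank_fintype_fun_eq_card, Fintype.card_fin] at hscale
  refine Eq.trans (hscale.trans ?_) rfl
  congr 1
  rw [volume_pi, ← setIntegral_congr_set Measure.univ_pi_Ioc_ae_eq_Icc]
  congr 2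
  ext x
  rw [Set.mem_smul_set_iff_inv_smul_mem₀ (by positivity)]
  simp only [Set.mem_ofPred_eq, Pi.smul_apply, smul_eq_mul, Set.mem_pi, Set.mem_univ, true_implies,
    Set.mem_Ioc]
  refine forall_congr' fun i => ?_
  rw [inv_mul_eq_div, div_lt_div_iff_of_pos_right (by positivity),
    div_add_one (by positivity), div_le_div_iff_of_pos_right (by positivity)]

/-- The linear form `ξ ↦ i⟨n,ξ⟩`, kept apart from its exponential because integral frequencies are
subtracted from exponents. -/
def frequencyForm (n : Fin d → ℤ) : (Fin d → ℝ) →L[ℝ] ℂ :=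
  Complex.I • ∑ j, (n j : ℂ) •
    (Complex.ofRealCLM.comp (ContinuousLinearMap.proj (R := ℝ) (φ := fun _ : Fin d => ℝ) j))

theorem frequencyForm_apply (n : Fin d → ℤ) (ξ : Fin d → ℝ) :
    frequencyForm n ξ = Complex.I * ∑ j, (n j : ℂ) * (ξ j : ℂ) := by
  simp [frequencyForm]

theorem frequencyForm_single (n : Fin d → ℤ) (i : Fin d) (t : ℝ) :
    frequencyForm n (Pi.single i t) = Complex.I * (n i * t) := by
  rw [frequencyForm_apply, Finset.sum_eq_single_of_mem i (Finset.mem_univ i), Pi.single_eq_same]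
  intro j _ hj
  simp [hj]

theorem re_frequencyForm (n : Fin d → ℤ) (ξ : Fin d → ℝ) : (frequencyForm n ξ).re = 0 := by
  have him : (∑ j, (n j : ℂ) * (ξ j : ℂ)).im = 0 := by simp
  rw [frequencyForm_apply, Complex.I_mul_re, him, neg_zero]

/-- The character `ξ ↦ exp(i⟨n,ξ⟩)` of the torus. -/
def character (n : Fin d → ℤ) (ξ : Fin d → ℝ) : ℂ :=
  Complex.exp (frequencyForm n ξ)

theorem character_neg (n : Fin d → ℤ) (ξ : Fin d → ℝ) :
    character (-n) ξ = Complex.exp (-(Complex.I * ∑ j, (n j : ℂ) * (ξ j : ℂ))) := by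
  simp [character, frequencyForm_apply]

theorem character_add (m n : Fin d → ℤ) (ξ : Fin d → ℝ) :
    character (m + n) ξ = character m ξ * character n ξ := by
  simp [character, frequencyForm_apply, ← Complex.exp_add, add_mul, Finset.sum_add_distrib, mul_add]

theorem norm_character (n : Fin d → ℤ) (ξ : Fin d → ℝ) : ‖character n ξ‖ = 1 := by
  rw [character, Complex.norm_exp, re_frequencyForm, Real.exp_zero]

theorem contDiff_character (n : Fin d → ℤ) (N : WithTop ℕ∞) : ContDiff ℝ N (character n) :=
  (frequencyForm n).contDiff.cexp

theorem torusPeriodic_character (n : Fin d → ℤ) : TorusPeriodic (character n) := by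
  intro ξ i
  have hperiod : frequencyForm n (Pi.single i (2 * π)) = n i * (2 * π * Complex.I) := by
    rw [frequencyForm_single]
    push_cast
    ring
  rw [character, map_add, hperiod, Complex.exp_add, Complex.exp_int_mul_two_pi_mul_I, mul_one,
    character]

theorem mFourier_coe (n : Fin d → ℤ) (y : Fin d → ℝ) :
    UnitAddTorus.mFourier n (fun i => (y i : UnitAddCircle)) =
      character n fun i => 2 * π * y i := by
  simp only [UnitAddTorus.mFourier, ContinuousMap.coe_mk, fourier_coe_apply, character,
    frequencyForm_apply, ← Complex.exp_sum, Finset.mul_sum]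
  congr 1
  refine Finset.sum_congr rfl fun j _ => ?_
  push_cast; ring

theorem fourierCoeff_eq_mFourierCoeff {f : (Fin d → ℝ) → ℂ} (hf : TorusPeriodic f)
    (n : Fin d → ℤ) : fourierCoeff f n = UnitAddTorus.mFourierCoeff (torusLift f) n := by
  have hmul (x : UnitAddTorus (Fin d)) : UnitAddTorus.mFourier (-n) x • torusLift f x =
      torusLift (f * character (-n)) x := by
    obtain ⟨y, rfl⟩ : ∃ y : Fin d → ℝ, (fun i => (y i : UnitAddCircle)) = x := by
      choose y hy using fun i => QuotientAddGroup.mk_surjective (x i)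
      exact ⟨y, funext hy⟩
    rw [mFourier_coe, torusLift_coe hf.latticePeriodic,
      torusLift_coe (hf.mul (torusPeriodic_character _)).latticePeriodic]
    simp [mul_comm]
  have hint := integral_torusLift (hf.mul (torusPeriodic_character (-n))).latticePeriodic 0
  simp only [zero_add] at hint
  rw [UnitAddTorus.mFourierCoeff]
  simp_rw [hmul]
  rw [hint, fourierCoeff, Complex.real_smul]
  congr 1
  · push_cast; rw [one_div]
  · simp only [Pi.mul_apply, character_neg]; rfl

/-- The lift of a continuous periodic function as a continuous map on the torus. -/
def torusMap {f : (Fin d → ℝ) → ℂ} (hf : TorusPeriodic f) (hc : Continuous f) :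
    C(UnitAddTorus (Fin d), ℂ) := ⟨torusLift f, continuous_torusLift hf.latticePeriodic hc⟩

/-- The mean square of a periodic function, computed over the period cube `[-π,π]^d` on which the
exponents decay. -/
def meanSq (f : (Fin d → ℝ) → ℂ) : ℝ :=
  ((2 * π) ^ d)⁻¹ * ∫ θ in Set.Icc (fun _ : Fin d => -π) (fun _ => π), ‖f θ‖ ^ 2

theorem hasSum_sq_fourierCoeff {f : (Fin d → ℝ) → ℂ} (hf : TorusPeriodic f) (hc : Continuous f) :
    HasSum (fun n => ‖fourierCoeff f n‖ ^ 2) (meanSq f) := by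
  have hparseval := UnitAddTorus.hasSum_sq_mFourierCoeff
    (ContinuousMap.toLp (E := ℂ) 2 volume ℂ (torusMap hf hc))
  simp_rw [UnitAddTorus.mFourierCoeff_toLp] at hparseval
  have hint : ∫ t, ‖(ContinuousMap.toLp (E := ℂ) 2 volume ℂ (torusMap hf hc)) t‖ ^ 2 =
      ∫ t, torusLift (fun θ => ‖f θ‖ ^ 2) t := by
    refine integral_congr_ae ?_
    filter_upwards [ContinuousMap.coeFn_toLp (p := 2) (𝕜 := ℂ) volume (torusMap hf hc)] with t ht
    rw [ht]; rfl
  rw [hint, integral_torusLift (hf.latticePeriodic.comp fun z => ‖z‖ ^ 2) (-π),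
    show -π + 2 * π = π by ring, smul_eq_mul] at hparseval
  simp_rw [fourierCoeff_eq_mFourierCoeff hf]
  exact hparseval

theorem MemWiener.hasSum_character {f : (Fin d → ℝ) → ℂ} (hf : MemWiener f) (ξ : Fin d → ℝ) :
    HasSum (fun n => fourierCoeff f n * character n ξ) (f ξ) := by
  have hsummable : Summable (UnitAddTorus.mFourierCoeff (torusMap hf.periodic hf.continuous)) := by
    refine Summable.of_norm (hf.summable.congr fun n => ?_)
    rw [fourierCoeff_eq_mFourierCoeff hf.periodic]; rfl
  have hseries := UnitAddTorus.hasSum_mFourier_series_apply_of_summable hsummable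
    (fun i => ((ξ i / (2 * π) : ℝ) : UnitAddCircle))
  have hξ : (fun i => 2 * π * (ξ i / (2 * π))) = ξ := by
    ext i; field_simp
  have hvalue : torusMap hf.periodic hf.continuous
      (fun i => ((ξ i / (2 * π) : ℝ) : UnitAddCircle)) = f ξ :=
    (torusLift_coe hf.periodic.latticePeriodic fun i => ξ i / (2 * π)).trans (congrArg f hξ)
  rw [hvalue] at hseries
  refine hseries.congr_fun fun n => ?_
  rw [mFourier_coe, hξ, fourierCoeff_eq_mFourierCoeff hf.periodic, smul_eq_mul]
  rfl

end Torus

section WienerNorm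

variable {d : ℕ} {f g : (Fin d → ℝ) → ℂ}

theorem wienerNorm_nonneg (f : (Fin d → ℝ) → ℂ) : 0 ≤ wienerNorm f :=
  tsum_nonneg fun _ => norm_nonneg _

theorem fourierCoeff_mul_character (f : (Fin d → ℝ) → ℂ) (m n : Fin d → ℤ) :
    fourierCoeff (f * character m) n = fourierCoeff f (n - m) := by
  simp only [fourierCoeff, ← character_neg, Pi.mul_apply]
  congr 2
  ext θ
  rw [show -(n - m) = m + -n by ring, character_add, mul_assoc]

theorem wienerNorm_mul_character (f : (Fin d → ℝ) → ℂ) (m : Fin d → ℤ) :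
    wienerNorm (f * character m) = wienerNorm f := by
  simp only [wienerNorm, fourierCoeff_mul_character]
  exact (Equiv.subRight m).tsum_eq (fun n => ‖fourierCoeff f n‖)

theorem fourierCoeff_add (hf : Continuous f) (hg : Continuous g) (n : Fin d → ℤ) :
    fourierCoeff (f + g) n = fourierCoeff f n + fourierCoeff g n := by
  have integrable {u : (Fin d → ℝ) → ℂ} (hu : Continuous u) :
      IntegrableOn (fun θ => u θ * character (-n) θ) (Set.Icc 0 fun _ => 2 * π) :=
    (hu.mul (contDiff_character (-n) 0).continuous).continuousOn.integrableOn_compact isCompact_Icc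
  simp only [fourierCoeff, ← character_neg, Pi.add_apply, add_mul]
  rw [integral_add (integrable hf) (integrable hg), mul_add]

theorem wienerNorm_add_le (hf : MemWiener f) (hg : MemWiener g) :
    wienerNorm (f + g) ≤ wienerNorm f + wienerNorm g := by
  have hle (n : Fin d → ℤ) :
      ‖fourierCoeff (f + g) n‖ ≤ ‖fourierCoeff f n‖ + ‖fourierCoeff g n‖ := by
    rw [fourierCoeff_add hf.continuous hg.continuous]
    exact norm_add_le _ _
  have hsum := hf.summable.add hg.summable
  exact (Summable.tsum_le_tsum hle (.of_nonneg_of_le (fun _ => norm_nonneg _) hle hsum) hsum).trans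
    (hf.summable.tsum_add hg.summable).le

theorem hasSum_fourierCoeff_mul (hf : MemWiener f) (hg : Continuous g) (m : Fin d → ℤ) :
    HasSum (fun n => fourierCoeff f n * fourierCoeff g (m - n)) (fourierCoeff (f * g) m) := by
  have hterm (n : Fin d → ℤ) : fourierCoeff f n * fourierCoeff g (m - n) =
      (1 / (2 * (π : ℂ)) ^ d) * ∫ θ in Set.Icc (0 : Fin d → ℝ) (fun _ => 2 * π),
        (fourierCoeff f n * character n θ) * (g θ * character (-m) θ) := by
    rw [← fourierCoeff_mul_character g n m]
    simp only [fourierCoeff, ← character_neg, Pi.mul_apply]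
    rw [mul_left_comm, ← integral_const_mul]
    congr 2
    ext θ
    ring
  have hprod : fourierCoeff (f * g) m = (1 / (2 * (π : ℂ)) ^ d) *
      ∫ θ in Set.Icc (0 : Fin d → ℝ) (fun _ => 2 * π),
        ∑' n, (fourierCoeff f n * character n θ) * (g θ * character (-m) θ) := by
    simp only [tsum_mul_right, (hf.hasSum_character _).tsum_eq]
    simp only [fourierCoeff, ← character_neg, Pi.mul_apply, mul_assoc]
  simp_rw [hterm]
  rw [hprod]
  refine HasSum.mul_left _ (hasSum_integral_of_summable_integral_norm (fun n => ?_) ?_)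
  · refine ContinuousOn.integrableOn_compact isCompact_Icc (Continuous.continuousOn ?_)
    have hn := (contDiff_character n 0).continuous
    have hm := (contDiff_character (-m) 0).continuous
    fun_prop
  · refine .of_nonneg_of_le (fun n => integral_nonneg fun _ => norm_nonneg _) (fun n => ?_)
      (hf.summable.mul_right (∫ θ in Set.Icc (0 : Fin d → ℝ) (fun _ => 2 * π), ‖g θ‖))
    simp only [norm_mul, norm_character, mul_one]
    rw [integral_const_mul]

theorem wienerNorm_mul_le (hf : MemWiener f) (hg : MemWiener g) :
    wienerNorm (f * g) ≤ wienerNorm f * wienerNorm g := by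
  have hs : Summable fun p : (Fin d → ℤ) × (Fin d → ℤ) =>
      ‖fourierCoeff f p.1‖ * ‖fourierCoeff g p.2‖ :=
    hf.summable.mul_of_nonneg hg.summable (fun _ => norm_nonneg _) fun _ => norm_nonneg _
  let e : (Fin d → ℤ) × (Fin d → ℤ) ≃ (Fin d → ℤ) × (Fin d → ℤ) :=
    { toFun := fun p => (p.2, p.1 - p.2)
      invFun := fun p => (p.1 + p.2, p.1)
      left_inv := fun p => by simp
      right_inv := fun p => by simp }
  have hs' : Summable fun p : (Fin d → ℤ) × (Fin d → ℤ) =>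
      ‖fourierCoeff f p.2‖ * ‖fourierCoeff g (p.1 - p.2)‖ := e.summable_iff.2 hs
  have hle (m : Fin d → ℤ) : ‖fourierCoeff (f * g) m‖ ≤
      ∑' n, ‖fourierCoeff f n‖ * ‖fourierCoeff g (m - n)‖ := by
    rw [← (hasSum_fourierCoeff_mul hf hg.continuous m).tsum_eq]
    simp_rw [← norm_mul]
    refine norm_tsum_le_tsum_norm ?_
    simpa only [norm_mul] using hs'.prod_factor m
  calc wienerNorm (f * g) ≤ ∑' m, ∑' n, ‖fourierCoeff f n‖ * ‖fourierCoeff g (m - n)‖ :=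
        Summable.tsum_le_tsum hle (.of_nonneg_of_le (fun _ => norm_nonneg _) hle hs'.prod) hs'.prod
    _ = ∑' p : (Fin d → ℤ) × (Fin d → ℤ), ‖fourierCoeff f p.2‖ * ‖fourierCoeff g (p.1 - p.2)‖ :=
        hs'.tsum_prod.symm
    _ = ∑' p : (Fin d → ℤ) × (Fin d → ℤ), ‖fourierCoeff f p.1‖ * ‖fourierCoeff g p.2‖ :=
        e.tsum_eq fun p => ‖fourierCoeff f p.1‖ * ‖fourierCoeff g p.2‖
    _ = wienerNorm f * wienerNorm g := (hf.summable.tsum_mul_tsum hg.summable hs).symm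

end WienerNorm

section DerivativeBounds

variable {E F : Type*} [NormedAddCommGroup E] [NormedSpace ℝ E] [NormedAddCommGroup F]
  [NormedSpace ℝ F] {N : ℕ} {a b c A B : ℝ} {x : E}

/-- At the point `x`, the derivatives of `f` up to order `N` grow at most like those of a function
of size `B` oscillating at frequency `a`. -/
def DerivBound (N : ℕ) (a B : ℝ) (f : E → F) (x : E) : Prop :=
  ∀ j ≤ N, ‖iteratedFDeriv ℝ j f x‖ ≤ B * a ^ j

theorem DerivBound.mono {f : E → F} (h : DerivBound N a A f x) (ha : 0 ≤ a) (hab : a ≤ b)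
    (hA : 0 ≤ A) (hAB : A ≤ B) : DerivBound N b B f x := fun j hj =>
  (h j hj).trans (mul_le_mul hAB (pow_le_pow_left₀ ha hab j) (pow_nonneg ha j) (hA.trans hAB))

theorem DerivBound.rescale {f : E → F} (h : DerivBound N (c * a) B f x) (hc : 1 ≤ c) (ha : 0 ≤ a)
    (hB : 0 ≤ B) : DerivBound N a (c ^ N * B) f x := fun j hj =>
  calc ‖iteratedFDeriv ℝ j f x‖ ≤ B * (c ^ j * a ^ j) := mul_pow c a j ▸ h j hj
    _ ≤ B * (c ^ N * a ^ j) := by gcongr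
    _ = c ^ N * B * a ^ j := by ring

theorem DerivBound.norm_le {f : E → F} (h : DerivBound N a B f x) : ‖f x‖ ≤ B := by
  simpa using h 0 (Nat.zero_le _)

theorem derivBound_const (ha : 0 ≤ a) (c : F) : DerivBound N a ‖c‖ (fun _ : E => c) x := by
  intro j _
  rcases eq_or_ne j 0 with rfl | hj
  · simp
  · rw [iteratedFDeriv_const_of_ne hj, Pi.zero_apply, norm_zero]
    positivity

theorem derivBound_of_eventuallyEq_zero {f : E → F} (h : f =ᶠ[𝓝 x] 0) (ha : 0 ≤ a) (hB : 0 ≤ B) :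
    DerivBound N a B f x := by
  intro j _
  have hzero : iteratedFDeriv ℝ j (0 : E → F) = 0 := iteratedFDeriv_zero
  rw [(h.iteratedFDeriv ℝ j).eq_of_nhds, hzero, Pi.zero_apply, norm_zero]
  positivity

theorem DerivBound.sub {f g : E → F} (hf : DerivBound N a A f x) (hg : DerivBound N a B g x)
    (hfc : ContDiff ℝ N f) (hgc : ContDiff ℝ N g) : DerivBound N a (A + B) (f - g) x := by
  intro j hj
  have hjN : (j : WithTop ℕ∞) ≤ N := by exact_mod_cast hj
  rw [iteratedFDeriv_sub_apply (hfc.of_le hjN).contDiffAt (hgc.of_le hjN).contDiffAt, add_mul]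
  exact (norm_sub_le _ _).trans (add_le_add (hf j hj) (hg j hj))

theorem DerivBound.mul {R : Type*} [NormedRing R] [NormedAlgebra ℝ R] {f g : E → R}
    (hf : DerivBound N a A f x) (hg : DerivBound N a B g x) (hfc : ContDiff ℝ N f)
    (hgc : ContDiff ℝ N g) (ha : 0 ≤ a) (hA : 0 ≤ A) (hB : 0 ≤ B) :
    DerivBound N a (2 ^ N * (A * B)) (f * g) x := by
  intro j hj
  have hterm : ∀ i ∈ Finset.range (j + 1), (j.choose i : ℝ) * ‖iteratedFDeriv ℝ i f x‖ *
      ‖iteratedFDeriv ℝ (j - i) g x‖ ≤ (j.choose i : ℝ) * (A * B * a ^ j) := by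
    intro i hi
    have hij : i ≤ j := Nat.lt_succ_iff.1 (Finset.mem_range.1 hi)
    calc (j.choose i : ℝ) * ‖iteratedFDeriv ℝ i f x‖ * ‖iteratedFDeriv ℝ (j - i) g x‖
        ≤ (j.choose i : ℝ) * (A * a ^ i) * (B * a ^ (j - i)) := by
          gcongr
          exacts [hf i (hij.trans hj), hg (j - i) ((Nat.sub_le _ _).trans hj)]
      _ = (j.choose i : ℝ) * (A * B * (a ^ i * a ^ (j - i))) := by ring
      _ = (j.choose i : ℝ) * (A * B * a ^ j) := by rw [← pow_add, Nat.add_sub_cancel' hij]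
  calc ‖iteratedFDeriv ℝ j (f * g) x‖
      ≤ ∑ i ∈ Finset.range (j + 1), (j.choose i : ℝ) * (A * B * a ^ j) :=
        (norm_iteratedFDeriv_mul_le hfc hgc x (by exact_mod_cast hj)).trans
          (Finset.sum_le_sum hterm)
    _ = 2 ^ j * (A * B * a ^ j) := by
        rw [← Finset.sum_mul, ← Nat.cast_sum, Nat.sum_range_choose]
        push_cast
        rfl
    _ ≤ 2 ^ N * (A * B * a ^ j) := by gcongr; norm_num
    _ = 2 ^ N * (A * B) * a ^ j := by ring

theorem DerivBound.comp {G : Type*} [NormedAddCommGroup G] [NormedSpace ℝ G] {g : F → G} {f : E → F}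
    (hg : DerivBound N 1 B g (f x)) (hf : ∀ j, 1 ≤ j → j ≤ N → ‖iteratedFDeriv ℝ j f x‖ ≤ a ^ j)
    (hgc : ContDiff ℝ N g) (hfc : ContDiff ℝ N f) (ha : 0 ≤ a) :
    DerivBound N a (N.factorial * B) (g ∘ f) x := by
  intro j hj
  have hB : 0 ≤ B := (norm_nonneg _).trans hg.norm_le
  calc ‖iteratedFDeriv ℝ j (g ∘ f) x‖ ≤ j.factorial * B * a ^ j :=
        norm_iteratedFDeriv_comp_le hgc hfc (by exact_mod_cast hj) x
          (fun i hi => (hg i (hi.trans hj)).trans_eq (by rw [one_pow, mul_one]))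
          fun i hi1 hi => hf i hi1 (hi.trans hj)
    _ ≤ N.factorial * B * a ^ j := by gcongr

theorem exists_norm_iteratedFDeriv_le_of_isCompact {f : E → F} (hf : ContDiff ℝ N f) {s : Set E}
    (hs : IsCompact s) :
    ∃ A : ℝ, 1 ≤ A ∧ ∀ j ≤ N, ∀ x ∈ s, ‖iteratedFDeriv ℝ j f x‖ ≤ A := by
  have hcont : Continuous fun x => ∑ j ∈ Finset.range (N + 1), ‖iteratedFDeriv ℝ j f x‖ :=
    continuous_finsetSum _ fun j hj => (hf.continuous_iteratedFDeriv
      (by exact_mod_cast Nat.lt_succ_iff.1 (Finset.mem_range.1 hj))).norm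
  obtain ⟨A, hA⟩ := hs.exists_bound_of_continuousOn hcont.continuousOn
  refine ⟨max 1 A, le_max_left _ _, fun j hj x hx => ?_⟩
  calc ‖iteratedFDeriv ℝ j f x‖ ≤ ∑ j ∈ Finset.range (N + 1), ‖iteratedFDeriv ℝ j f x‖ :=
        Finset.single_le_sum (f := fun j => ‖iteratedFDeriv ℝ j f x‖) (fun _ _ => norm_nonneg _)
          (Finset.mem_range.2 (Nat.lt_succ_iff.2 hj))
    _ ≤ A := (le_abs_self _).trans (hA x hx)
    _ ≤ max 1 A := le_max_right _ _

theorem exists_derivBound_of_hasCompactSupport {f : E → F} (hf : ContDiff ℝ N f)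
    (hs : HasCompactSupport f) : ∃ A : ℝ, 1 ≤ A ∧ ∀ x, DerivBound N 1 A f x := by
  obtain ⟨A, hA1, hA⟩ := exists_norm_iteratedFDeriv_le_of_isCompact hf hs
  refine ⟨A, hA1, fun x => ?_⟩
  by_cases hx : x ∈ tsupport f
  · exact fun j hj => (hA j hj x hx).trans_eq (by rw [one_pow, mul_one])
  · exact derivBound_of_eventuallyEq_zero (notMem_tsupport_iff_eventuallyEq.1 hx) zero_le_one
      (zero_le_one.trans hA1)

end DerivativeBounds

section Taylor

variable {E F : Type*} [NormedAddCommGroup E] [NormedSpace ℝ E] [NormedAddCommGroup F]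
  [NormedSpace ℝ F]

/-- `h` is of class `𝒞^{r+1}` and its derivatives of order at most `r` vanish at the origin. -/
structure VanishesToOrder (r : ℕ) (h : E → F) : Prop where
  contDiff : ContDiff ℝ ((r + 1 : ℕ) : WithTop ℕ∞) h
  iteratedFDeriv_eq_zero : ∀ n ≤ r, iteratedFDeriv ℝ n h 0 = 0

theorem norm_le_of_norm_fderiv_le_pow {f : E → F} (hf : Differentiable ℝ f) (h0 : f 0 = 0)
    {B ε : ℝ} {m : ℕ} (hB : ∀ x, ‖x‖ ≤ ε → ‖fderiv ℝ f x‖ ≤ B * ‖x‖ ^ m) {x : E} (hx : ‖x‖ ≤ ε) :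
    ‖f x‖ ≤ B * ‖x‖ ^ (m + 1) / (m + 1) := by
  have hline (t : ℝ) : HasDerivAt (fun t : ℝ => f (t • x)) (fderiv ℝ f (t • x) x) t :=
    (hf (t • x)).hasFDerivAt.comp_hasDerivAt t (by simpa using (hasDerivAt_id t).smul_const x)
  have hmajorant (t : ℝ) : HasDerivAt (fun t : ℝ => B * ‖x‖ ^ (m + 1) * (t ^ (m + 1) / (m + 1)))
      (B * ‖x‖ ^ (m + 1) * t ^ m) t := by
    refine HasDerivAt.const_mul _ ?_
    convert (hasDerivAt_pow (m + 1) t).div_const ((m : ℝ) + 1) using 1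
    push_cast
    field_simp
  have hderiv : ∀ t ∈ Set.Ico (0 : ℝ) 1, ‖fderiv ℝ f (t • x) x‖ ≤ B * ‖x‖ ^ (m + 1) * t ^ m := by
    intro t ht
    have hn : ‖t • x‖ = t * ‖x‖ := by rw [norm_smul, Real.norm_eq_abs, abs_of_nonneg ht.1]
    have hball : ‖t • x‖ ≤ ε := by
      rw [hn]
      exact (mul_le_of_le_one_left (norm_nonneg x) ht.2.le).trans hx
    calc ‖fderiv ℝ f (t • x) x‖ ≤ ‖fderiv ℝ f (t • x)‖ * ‖x‖ := ContinuousLinearMap.le_opNorm _ _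
      _ ≤ (B * ‖t • x‖ ^ m) * ‖x‖ := by gcongr; exact hB _ hball
      _ = B * ‖x‖ ^ (m + 1) * t ^ m := by rw [hn]; ring
  have hbound := image_norm_le_of_norm_deriv_right_le_deriv_boundary (a := 0) (b := 1)
    (fun t _ => (hline t).continuousAt.continuousWithinAt)
    (fun t _ => (hline t).hasDerivWithinAt) (by simp [h0]) hmajorant hderiv (x := 1) (by simp)
  simpa [div_eq_mul_inv] using hbound

theorem VanishesToOrder.norm_iteratedFDeriv_le {h : E → F} {r : ℕ} (hh : VanishesToOrder r h)
    {T ε : ℝ} (hT : ∀ x, ‖x‖ ≤ ε → ‖iteratedFDeriv ℝ (r + 1) h x‖ ≤ T) {j m : ℕ}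
    (hjm : j + m = r + 1) {x : E} (hx : ‖x‖ ≤ ε) :
    ‖iteratedFDeriv ℝ j h x‖ ≤ T / m.factorial * ‖x‖ ^ m := by
  induction m generalizing j x with
  | zero =>
    obtain rfl : j = r + 1 := by omega
    simpa using hT x hx
  | succ m ih =>
    refine (norm_le_of_norm_fderiv_le_pow (f := iteratedFDeriv ℝ j h)
      (hh.contDiff.differentiable_iteratedFDeriv (by exact_mod_cast (by omega : j < r + 1)))
      (hh.iteratedFDeriv_eq_zero j (by omega)) (B := T / m.factorial) (m := m)
      (fun y hy => ?_) hx).trans_eq ?_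
    · rw [norm_fderiv_iteratedFDeriv]
      exact ih (j := j + 1) (by omega) hy
    · rw [Nat.factorial_succ]
      push_cast
      field_simp

-- Absorbing `c ^ m / m!` into `exp c` keeps the bound independent of `r`.
theorem VanishesToOrder.derivBound {h : E → F} {r k : ℕ} (hh : VanishesToOrder r h)
    (hk : k ≤ r + 1) {b c ε : ℝ} (hb : 0 ≤ b) (hc : 0 ≤ c) (hε : 0 < ε)
    (hT : ∀ x, ‖x‖ ≤ ε → ‖iteratedFDeriv ℝ (r + 1) h x‖ ≤ c ^ (r + 1) * b) {x : E}
    (hx : ‖x‖ ≤ ε) : DerivBound k (c * (1 / ε)) (Real.exp c * (ε ^ (r + 1) * b)) h x := by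
  intro j hj
  obtain ⟨m, hm⟩ : ∃ m, j + m = r + 1 := ⟨r + 1 - j, by omega⟩
  calc ‖iteratedFDeriv ℝ j h x‖
      ≤ c ^ (r + 1) * b / m.factorial * ‖x‖ ^ m := hh.norm_iteratedFDeriv_le hT hm hx
    _ ≤ c ^ (r + 1) * b / m.factorial * ε ^ m := by gcongr
    _ = c ^ j * (c ^ m / m.factorial) * (ε ^ m * b) := by rw [← hm, pow_add]; ring
    _ ≤ c ^ j * Real.exp c * (ε ^ m * b) := by
        gcongr
        exact Real.pow_div_factorial_le_exp _ hc m
    _ = Real.exp c * (ε ^ (r + 1) * b) * (c * (1 / ε)) ^ j := by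
        rw [← hm, pow_add, mul_pow, one_div, inv_pow]
        field_simp

end Taylor

section PartialDerivatives

variable {d n : ℕ}

theorem opNorm_le_of_apply_single_le {F : Type*} [NormedAddCommGroup F] [NormedSpace ℝ F]
    (T : ContinuousMultilinearMap ℝ (fun _ : Fin n => Fin d → ℝ) F) {β : ℝ} (hβ0 : 0 ≤ β)
    (hβ : ∀ s : Fin n → Fin d, ‖T fun j => Pi.single (s j) 1‖ ≤ β) : ‖T‖ ≤ d ^ n * β := by
  refine ContinuousMultilinearMap.opNorm_le_bound (by positivity) fun v => ?_
  have hexpand : T v = ∑ s : Fin n → Fin d, (∏ j, v j (s j)) • T fun j => Pi.single (s j) 1 := by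
    have hv : v = fun j => ∑ i, v j i • (Pi.single i 1 : Fin d → ℝ) := by
      ext j i; simp [Finset.sum_apply, Pi.single_apply]
    conv_lhs => rw [hv]
    rw [ContinuousMultilinearMap.map_sum]
    exact Finset.sum_congr rfl fun s _ => ContinuousMultilinearMap.map_smul_univ _ _ _
  rw [hexpand]
  calc _ ≤ ∑ _s : Fin n → Fin d, (∏ j, ‖v j‖) * β := by
        refine norm_sum_le_of_le _ fun s _ => ?_
        rw [norm_smul, norm_prod]
        gcongr with j
        exacts [norm_le_pi_norm (v j) (s j), hβ s]
    _ = _ := by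
        simp only [Finset.sum_const, Finset.card_univ, Fintype.card_pi, Fintype.card_fin,
          Finset.prod_const, nsmul_eq_mul]
        push_cast; ring

variable {f : (Fin d → ℝ) → ℂ}

theorem iteratedFDeriv_eq_zero_of_partialDeriv_eq_zero {ξ : Fin d → ℝ}
    (hf : ∀ s : Fin n → Fin d, partialDeriv s f ξ = 0) : iteratedFDeriv ℝ n f ξ = 0 :=
  norm_le_zero_iff.1 <| (opNorm_le_of_apply_single_le _ le_rfl fun s =>
    (norm_eq_zero.2 (hf s)).le).trans_eq (mul_zero _)

theorem norm_partialDeriv_le (s : Fin n → Fin d) (f : (Fin d → ℝ) → ℂ) (ξ : Fin d → ℝ) :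
    ‖partialDeriv s f ξ‖ ≤ ‖iteratedFDeriv ℝ n f ξ‖ := by
  simpa [partialDeriv, Pi.norm_single] using
    (iteratedFDeriv ℝ n f ξ).le_opNorm fun j => (Pi.single (s j) 1 : Fin d → ℝ)

theorem bddAbove_norm_partialDeriv (hf : ContDiff ℝ n f) (ε : ℝ) :
    BddAbove {x : ℝ | ∃ (s : Fin n → Fin d) (ξ : Fin d → ℝ),
      (∀ i, |ξ i| ≤ ε) ∧ x = ‖partialDeriv s f ξ‖} := by
  obtain ⟨A, -, hA⟩ := exists_norm_iteratedFDeriv_le_of_isCompact hf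
    (isCompact_closedBall (0 : Fin d → ℝ) |ε|)
  refine ⟨A, ?_⟩
  rintro x ⟨s, ξ, hξ, rfl⟩
  refine (norm_partialDeriv_le s f ξ).trans (hA n le_rfl ξ (mem_closedBall_zero_iff.2 ?_))
  exact (pi_norm_le_iff_of_nonneg (abs_nonneg ε)).2 fun i => (hξ i).trans (le_abs_self ε)

theorem betaSup_nonneg (n : ℕ) (f : (Fin d → ℝ) → ℂ) (ε : ℝ) : 0 ≤ betaSup n f ε := by
  refine Real.sSup_nonneg ?_
  rintro x ⟨s, ξ, -, rfl⟩
  exact norm_nonneg _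

theorem betaSup_mono (hf : ContDiff ℝ n f) {ε ε' : ℝ} (h : ε ≤ ε') :
    betaSup n f ε ≤ betaSup n f ε' := by
  refine Real.sSup_le ?_ (betaSup_nonneg n f ε')
  rintro x ⟨s, ξ, hξ, rfl⟩
  exact le_csSup (bddAbove_norm_partialDeriv hf ε') ⟨s, ξ, fun i => (hξ i).trans h, rfl⟩

theorem norm_iteratedFDeriv_le_betaSup (hf : ContDiff ℝ n f) {ε : ℝ} {ξ : Fin d → ℝ}
    (hξ : ‖ξ‖ ≤ ε) : ‖iteratedFDeriv ℝ n f ξ‖ ≤ d ^ n * betaSup n f ε :=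
  opNorm_le_of_apply_single_le _ (betaSup_nonneg n f ε) fun s =>
    le_csSup (bddAbove_norm_partialDeriv hf ε) ⟨s, ξ, fun i => (norm_le_pi_norm ξ i).trans hξ, rfl⟩

theorem VanishesToOrder.derivBound_betaSup {r k : ℕ} (hf : VanishesToOrder r f) (hk : k ≤ r + 1)
    {ε : ℝ} (hε : 0 < ε) {ξ : Fin d → ℝ} (hξ : ‖ξ‖ ≤ ε) :
    DerivBound k (1 / ε) ((1 + d) ^ k * (Real.exp d * (ε ^ (r + 1) * betaSup (r + 1) f ε)))
      f ξ := by
  have hβ := betaSup_nonneg (r + 1) f ε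
  have htaylor := hf.derivBound hk hβ (Nat.cast_nonneg d) hε
    (fun x hx => norm_iteratedFDeriv_le_betaSup hf.contDiff hx) hξ
  refine (htaylor.mono (by positivity) (b := (1 + d) * (1 / ε)) ?_ (by positivity) le_rfl).rescale
    (by simp) (by positivity) (by positivity)
  gcongr
  exact le_add_of_nonneg_left zero_le_one

end PartialDerivatives

section DirectionalDerivative

variable {d : ℕ} {f : (Fin d → ℝ) → ℂ}

/-- The derivative in the `i`-th coordinate direction, as an operator that can be iterated. -/
def dirDeriv (i : Fin d) (f : (Fin d → ℝ) → ℂ) (ξ : Fin d → ℝ) : ℂ :=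
  fderiv ℝ f ξ (Pi.single i 1)

theorem TorusPeriodic.dirDeriv (hf : TorusPeriodic f) (i : Fin d) :
    TorusPeriodic (dirDeriv i f) := by
  intro ξ j
  have htranslate := fderiv_comp_add_right (𝕜 := ℝ) (f := f) (x := ξ) (Pi.single j (2 * π))
  rw [funext fun x => hf x j] at htranslate
  rw [MultiWiener.dirDeriv, MultiWiener.dirDeriv, htranslate]

theorem contDiff_dirDeriv {n : ℕ} (hf : ContDiff ℝ ((n + 1 : ℕ) : WithTop ℕ∞) f) (i : Fin d) :
    ContDiff ℝ n (dirDeriv i f) :=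
  (hf.fderiv_right (m := (n : WithTop ℕ∞)) (by norm_cast)).clm_apply contDiff_const

theorem continuous_dirDeriv (hf : ContDiff ℝ 1 f) (i : Fin d) : Continuous (dirDeriv i f) :=
  (contDiff_dirDeriv (n := 0) (by simpa using hf) i).continuous

theorem TorusPeriodic.apply_insertNth_two_pi {d : ℕ} {f : (Fin (d + 1) → ℝ) → ℂ}
    (hf : TorusPeriodic f) (i : Fin (d + 1)) (x : Fin d → ℝ) :
    f (i.insertNth (2 * π) x) = f (i.insertNth 0 x) := by
  rw [← hf (i.insertNth 0 x) i]
  congr 1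
  ext k
  refine Fin.succAboveCases i ?_ (fun k => ?_) k
  · simp
  · simp [Fin.succAbove_ne]

theorem integral_dirDeriv (hf : TorusPeriodic f) (hc : ContDiff ℝ 1 f) (i : Fin d) :
    ∫ θ in Set.Icc (0 : Fin d → ℝ) (fun _ => 2 * π), dirDeriv i f θ = 0 := by
  obtain _ | d := d
  · exact i.elim0
  have hdiv (x : Fin (d + 1) → ℝ) :
      ∑ j, (if j = i then fderiv ℝ f x else 0) (Pi.single j (1 : ℝ)) = dirDeriv i f x := by
    rw [Finset.sum_eq_single i (fun j _ hj => by simp [hj]) (by simp), if_pos rfl, dirDeriv]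
  have hcont (j : Fin (d + 1)) : Continuous (if j = i then f else 0) := by
    split_ifs
    exacts [hc.continuous, continuous_zero]
  have hderiv (x : Fin (d + 1) → ℝ) (j : Fin (d + 1)) :
      HasFDerivAt (if j = i then f else 0) (if j = i then fderiv ℝ f x else 0) x := by
    split_ifs
    exacts [(hc.differentiable one_ne_zero x).hasFDerivAt, hasFDerivAt_const _ _]
  have hint : IntegrableOn
      (fun x => ∑ j, (if j = i then fderiv ℝ f x else 0) (Pi.single j (1 : ℝ)))
      (Set.Icc (0 : Fin (d + 1) → ℝ) fun _ => 2 * π) := by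
    simp_rw [hdiv]
    exact (continuous_dirDeriv hc i).continuousOn.integrableOn_compact isCompact_Icc
  have hfaces := integral_divergence_of_hasFDerivAt_off_countable' (0 : Fin (d + 1) → ℝ)
    (fun _ => 2 * π) (fun _ => by simp only [Pi.zero_apply]; positivity)
    (fun j => if j = i then f else 0) (fun j x => if j = i then fderiv ℝ f x else 0) ∅
    Set.countable_empty (fun j => (hcont j).continuousOn) (fun x _ j => hderiv x j) hint
  simp_rw [hdiv] at hfaces
  rw [hfaces]
  refine Finset.sum_eq_zero fun j _ => ?_
  split_ifs with hj
  · subst hj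
    simp only [hf.apply_insertNth_two_pi, Pi.zero_apply, sub_self]
  · simp

theorem dirDeriv_character (n : Fin d → ℤ) (i : Fin d) (ξ : Fin d → ℝ) :
    dirDeriv i (character n) ξ = Complex.I * n i * character n ξ := by
  rw [dirDeriv, show character n = fun x => Complex.exp (frequencyForm n x) from rfl,
    (frequencyForm n).hasFDerivAt.cexp.fderiv, smul_apply, smul_eq_mul, frequencyForm_single]
  push_cast
  ring

theorem fourierCoeff_dirDeriv (hf : TorusPeriodic f) (hc : ContDiff ℝ 1 f) (i : Fin d)
    (n : Fin d → ℤ) : fourierCoeff (dirDeriv i f) n = Complex.I * n i * fourierCoeff f n := by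
  have hch := contDiff_character (-n) 1
  have hleibniz (θ : Fin d → ℝ) : dirDeriv i (f * character (-n)) θ =
      dirDeriv i f θ * character (-n) θ - Complex.I * n i * (f θ * character (-n) θ) := by
    have hn := dirDeriv_character (-n) i θ
    rw [dirDeriv] at hn
    rw [dirDeriv, fderiv_mul (hc.differentiable one_ne_zero θ) (hch.differentiable one_ne_zero θ)]
    simp only [add_apply, smul_apply, smul_eq_mul, hn, dirDeriv, Pi.neg_apply, Int.cast_neg]
    ring
  have hparts := integral_dirDeriv (hf.mul (torusPeriodic_character (-n))) (hc.mul hch) i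
  simp_rw [hleibniz] at hparts
  rw [integral_sub, integral_const_mul, sub_eq_zero] at hparts
  · simp only [fourierCoeff, ← character_neg]
    rw [hparts]; ring
  · exact ((continuous_dirDeriv hc i).mul hch.continuous).continuousOn.integrableOn_compact
      isCompact_Icc
  · exact (continuous_const.mul
      (hc.continuous.mul hch.continuous)).continuousOn.integrableOn_compact isCompact_Icc

theorem TorusPeriodic.iterate_dirDeriv (hf : TorusPeriodic f) (i : Fin d) (k : ℕ) :
    TorusPeriodic ((MultiWiener.dirDeriv i)^[k] f) := by
  induction k with
  | zero => exact hf
  | succ k ih => rw [Function.iterate_succ_apply']; exact ih.dirDeriv i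

theorem contDiff_iterate_dirDeriv {N k : ℕ} (hc : ContDiff ℝ ((N + k : ℕ) : WithTop ℕ∞) f)
    (i : Fin d) : ContDiff ℝ N ((dirDeriv i)^[k] f) := by
  induction k generalizing N with
  | zero => exact hc
  | succ k ih =>
    rw [Function.iterate_succ_apply']
    exact contDiff_dirDeriv (ih (by rwa [add_right_comm])) i

theorem iterate_dirDeriv_apply {k : ℕ} (hc : ContDiff ℝ k f) (i : Fin d) (ξ : Fin d → ℝ) :
    (dirDeriv i)^[k] f ξ = iteratedFDeriv ℝ k f ξ fun _ => Pi.single i 1 := by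
  induction k generalizing ξ with
  | zero => simp
  | succ k ih =>
    have hdiff : DifferentiableAt ℝ (iteratedFDeriv ℝ k f) ξ :=
      hc.differentiable_iteratedFDeriv (by exact_mod_cast k.lt_succ_self) ξ
    have heval := (ContinuousMultilinearMap.apply ℝ (fun _ : Fin k => Fin d → ℝ) ℂ
      (fun _ => Pi.single i 1)).hasFDerivAt.comp ξ hdiff.hasFDerivAt
    rw [iteratedFDeriv_succ_apply_left, Function.iterate_succ_apply',
      funext (ih (hc.of_le (by exact_mod_cast k.le_succ))), dirDeriv]
    exact congrArg (fun L => L (Pi.single i (1 : ℝ))) heval.fderiv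

theorem norm_iterate_dirDeriv_le {k : ℕ} (hc : ContDiff ℝ k f) (i : Fin d) (ξ : Fin d → ℝ) :
    ‖(dirDeriv i)^[k] f ξ‖ ≤ ‖iteratedFDeriv ℝ k f ξ‖ := by
  rw [iterate_dirDeriv_apply hc]
  simpa [Pi.norm_single] using
    (iteratedFDeriv ℝ k f ξ).le_opNorm fun _ => (Pi.single i 1 : Fin d → ℝ)

theorem fourierCoeff_iterate_dirDeriv (hf : TorusPeriodic f) {k : ℕ} (hc : ContDiff ℝ k f)
    (i : Fin d) (n : Fin d → ℤ) :
    fourierCoeff ((dirDeriv i)^[k] f) n = (Complex.I * n i) ^ k * fourierCoeff f n := by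
  induction k with
  | zero => simp
  | succ k ih =>
    have hk : ContDiff ℝ 1 ((dirDeriv i)^[k] f) := by
      exact_mod_cast contDiff_iterate_dirDeriv (N := 1) (by rwa [add_comm]) i
    rw [Function.iterate_succ_apply', fourierCoeff_dirDeriv (hf.iterate_dirDeriv i k) hk,
      ih (hc.of_le (by exact_mod_cast k.le_succ))]
    ring

theorem sq_norm_fourierCoeff_iterate_dirDeriv (hf : TorusPeriodic f) {k : ℕ}
    (hc : ContDiff ℝ k f) (i : Fin d) (n : Fin d → ℤ) :
    ‖fourierCoeff ((dirDeriv i)^[k] f) n‖ ^ 2 = ‖n i‖ ^ (2 * k) * ‖fourierCoeff f n‖ ^ 2 := by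
  rw [fourierCoeff_iterate_dirDeriv hf hc, norm_mul, mul_pow, norm_pow, norm_mul, Complex.norm_I,
    one_mul, ← pow_mul, mul_comm k 2, Complex.norm_intCast, Int.norm_eq_abs]

end DirectionalDerivative

section LatticeSums

variable {d p : ℕ}

theorem summable_inv_one_add_norm_pow (hp : d < p) :
    Summable fun q : Fin d → ℤ => ((1 + ‖q‖) ^ p)⁻¹ := by
  let L := Submodule.span ℤ (Set.range (Pi.basisFun ℝ (Fin d)))
  have hrank : Module.finrank ℤ L = d := by
    rw [ZLattice.rank ℝ L]; simp
  have hmem (q : Fin d → ℤ) : (fun i => (q i : ℝ)) ∈ L := by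
    have hq : (fun i => (q i : ℝ)) = ∑ i, q i • Pi.basisFun ℝ (Fin d) i := by
      ext j; simp [Finset.sum_apply, Pi.single_apply]
    rw [hq]
    exact Submodule.sum_mem _ fun i _ => Submodule.smul_mem _ _
      (Submodule.subset_span (Set.mem_range_self i))
  let toLattice : (Fin d → ℤ) → L := fun q => ⟨fun i => (q i : ℝ), hmem q⟩
  have hinj : Function.Injective toLattice := fun q q' h => funext fun i =>
    Int.cast_injective (α := ℝ) (congrFun (congrArg Subtype.val h) i)
  have hnorm (q : Fin d → ℤ) : ‖toLattice q‖ = ‖q‖ := rfl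
  have hs : Summable fun q : Fin d → ℤ => ‖q‖⁻¹ ^ p :=
    ((ZLattice.summable_norm_pow_inv L p (by rwa [hrank])).comp_injective hinj).congr
      fun q => by rw [Function.comp_apply, hnorm]
  refine .of_norm_bounded_eventually hs ?_
  filter_upwards [(Set.finite_singleton (0 : Fin d → ℤ)).compl_mem_cofinite] with q hq
  have hq0 : 0 < ‖q‖ := norm_pos_iff.2 hq
  rw [Real.norm_of_nonneg (by positivity), inv_pow]
  gcongr
  exact le_add_of_nonneg_left zero_le_one

theorem summable_inv_add_norm_pow (hp : d < p) {a : ℝ} (ha : 1 ≤ a) :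
    Summable fun q : Fin d → ℤ => ((a + ‖q‖) ^ p)⁻¹ :=
  .of_nonneg_of_le (fun _ => by positivity) (fun _ => by gcongr) (summable_inv_one_add_norm_pow hp)

/-- Coordinatewise division with remainder by `A`, which splits `ℤ^d` into cubes of side `A`. -/
def latticeDivMod (d A : ℕ) [NeZero A] : (Fin d → ℤ) ≃ (Fin d → ℤ) × (Fin d → Fin A) :=
  (Equiv.piCongrRight fun _ => Int.divModEquiv A).trans (Equiv.arrowProdEquivProdArrow _ _ _)

theorem mul_norm_le_norm_latticeDivMod_symm {A : ℕ} [NeZero A] (q : Fin d → ℤ)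
    (s : Fin d → Fin A) : A * ‖q‖ ≤ ‖(latticeDivMod d A).symm (q, s)‖ + A := by
  have hA : (0 : ℝ) < A := by exact_mod_cast NeZero.pos A
  have happly (i : Fin d) : (latticeDivMod d A).symm (q, s) i = q i * A + ((s i : ℕ) : ℤ) := rfl
  suffices ‖q‖ ≤ (‖(latticeDivMod d A).symm (q, s)‖ + A) / A by
    rwa [le_div_iff₀ hA, mul_comm] at this
  refine (pi_norm_le_iff_of_nonneg (by positivity)).2 fun i => ?_
  have hcoord := norm_le_pi_norm ((latticeDivMod d A).symm (q, s)) i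
  have hrem : ((s i : ℕ) : ℝ) ≤ A := by exact_mod_cast (s i).2.le
  simp only [happly, Int.norm_eq_abs] at hcoord ⊢
  push_cast at hcoord
  rw [le_div_iff₀ hA]
  calc |(q i : ℝ)| * A = |(q i * A + (s i : ℕ) : ℝ) - (s i : ℕ)| := by
        rw [add_sub_cancel_right, abs_mul, Nat.abs_cast]
    _ ≤ |(q i * A + (s i : ℕ) : ℝ)| + |((s i : ℕ) : ℝ)| := abs_sub _ _
    _ ≤ ‖(latticeDivMod d A).symm (q, s)‖ + A := by rw [Nat.abs_cast]; gcongr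

theorem inv_add_norm_latticeDivMod_symm_pow_le {a : ℝ} {A : ℕ} [NeZero A] (hAa : A ≤ a)
    (haA : a ≤ 2 * A) (q : Fin d → ℤ) (s : Fin d → Fin A) :
    ((a + ‖(latticeDivMod d A).symm (q, s)‖) ^ p)⁻¹ ≤ (4 / a) ^ p * ((1 + ‖q‖) ^ p)⁻¹ := by
  have ha : 0 < a := lt_of_lt_of_le (by exact_mod_cast NeZero.pos A) hAa
  have hlower : a / 4 * (1 + ‖q‖) ≤ a + ‖(latticeDivMod d A).symm (q, s)‖ := by
    nlinarith [mul_norm_le_norm_latticeDivMod_symm q s, norm_nonneg q,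
      norm_nonneg ((latticeDivMod d A).symm (q, s))]
  calc ((a + ‖(latticeDivMod d A).symm (q, s)‖) ^ p)⁻¹ ≤ ((a / 4 * (1 + ‖q‖)) ^ p)⁻¹ := by gcongr
    _ = (4 / a) ^ p * ((1 + ‖q‖) ^ p)⁻¹ := by rw [mul_pow, mul_inv, ← inv_pow (a / 4), inv_div]

theorem exists_tsum_inv_add_norm_pow_le (hp : d < p) :
    ∃ C : ℝ, 0 ≤ C ∧ ∀ a : ℝ, 1 ≤ a →
      ∑' n : Fin d → ℤ, ((a + ‖n‖) ^ p)⁻¹ ≤ C * (a ^ d * (a ^ p)⁻¹) := by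
  set S := ∑' q : Fin d → ℤ, ((1 + ‖q‖) ^ p)⁻¹
  have hS : 0 ≤ S := tsum_nonneg fun q => by positivity
  refine ⟨4 ^ p * S, by positivity, fun a ha => ?_⟩
  have hfloor : 1 ≤ ⌊a⌋₊ := (Nat.one_le_floor_iff a).2 ha
  have : NeZero ⌊a⌋₊ := ⟨by omega⟩
  have hAa : (⌊a⌋₊ : ℝ) ≤ a := Nat.floor_le (by linarith)
  have haA : a ≤ 2 * ⌊a⌋₊ := by
    have : (1 : ℝ) ≤ ⌊a⌋₊ := by exact_mod_cast hfloor
    linarith [Nat.lt_floor_add_one a]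
  let e := latticeDivMod d ⌊a⌋₊
  have hle (x : (Fin d → ℤ) × (Fin d → Fin ⌊a⌋₊)) :
      ((a + ‖e.symm x‖) ^ p)⁻¹ ≤ (4 / a) ^ p * ((1 + ‖x.1‖) ^ p)⁻¹ * 1 := by
    rw [mul_one]
    exact inv_add_norm_latticeDivMod_symm_pow_le hAa haA x.1 x.2
  have hcubes : Summable fun _ : Fin d → Fin ⌊a⌋₊ => (1 : ℝ) := Summable.of_finite
  have hbase := (summable_inv_one_add_norm_pow hp).mul_left ((4 / a) ^ p)
  have hprod := hbase.mul_of_nonneg hcubes (fun q => by positivity) fun _ => zero_le_one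
  calc ∑' n : Fin d → ℤ, ((a + ‖n‖) ^ p)⁻¹ = ∑' x, ((a + ‖e.symm x‖) ^ p)⁻¹ :=
        (e.symm.tsum_eq _).symm
    _ ≤ ∑' x : (Fin d → ℤ) × (Fin d → Fin ⌊a⌋₊), (4 / a) ^ p * ((1 + ‖x.1‖) ^ p)⁻¹ * 1 :=
        (e.symm.summable_iff.2 (summable_inv_add_norm_pow hp ha)).tsum_le_tsum hle hprod
    _ = (∑' q : Fin d → ℤ, (4 / a) ^ p * ((1 + ‖q‖) ^ p)⁻¹) * ∑' _ : Fin d → Fin ⌊a⌋₊, (1 : ℝ) :=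
        (hbase.tsum_mul_tsum hcubes hprod).symm
    _ = (4 / a) ^ p * S * ⌊a⌋₊ ^ d := by rw [tsum_mul_left]; simp [S]
    _ ≤ (4 / a) ^ p * S * a ^ d := by gcongr
    _ = 4 ^ p * S * (a ^ d * (a ^ p)⁻¹) := by rw [div_pow]; ring

end LatticeSums

section Sobolev

variable {d k : ℕ} {f : (Fin d → ℝ) → ℂ}

theorem summable_mul_and_sq_tsum_le {ι : Type*} {u v : ι → ℝ} (hu : ∀ i, 0 ≤ u i)
    (hv : ∀ i, 0 ≤ v i) (hus : Summable fun i => u i ^ 2) (hvs : Summable fun i => v i ^ 2) :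
    (Summable fun i => u i * v i) ∧
      (∑' i, u i * v i) ^ 2 ≤ (∑' i, u i ^ 2) * ∑' i, v i ^ 2 := by
  obtain ⟨hsummable, hholder⟩ := Real.summable_and_inner_le_Lp_mul_Lq_tsum_of_nonneg (p := 2)
    (q := 2) Real.HolderConjugate.two_two hu hv (by simpa using hus) (by simpa using hvs)
  simp only [Real.rpow_two, ← Real.sqrt_eq_rpow] at hholder
  refine ⟨hsummable, ?_⟩
  calc (∑' i, u i * v i) ^ 2 ≤ (√(∑' i, u i ^ 2) * √(∑' i, v i ^ 2)) ^ 2 :=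
        pow_le_pow_left₀ (tsum_nonneg fun i => mul_nonneg (hu i) (hv i)) hholder 2
    _ = _ := by
        rw [mul_pow, Real.sq_sqrt (tsum_nonneg fun i => sq_nonneg _),
          Real.sq_sqrt (tsum_nonneg fun i => sq_nonneg _)]

theorem pi_norm_pow_le_sum {ι : Type*} [Fintype ι] {E : ι → Type*}
    [∀ i, SeminormedAddCommGroup (E i)] {p : ℕ} (hp : p ≠ 0) (x : ∀ i, E i) :
    ‖x‖ ^ p ≤ ∑ i, ‖x i‖ ^ p := by
  rcases isEmpty_or_nonempty ι with hι | hι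
  · simp [Pi.norm_def, hp]
  obtain ⟨i, -, hi⟩ := Finset.exists_mem_eq_sup Finset.univ Finset.univ_nonempty fun i => ‖x i‖₊
  have hnorm : ‖x‖ = ‖x i‖ := by rw [Pi.norm_def, hi, coe_nnnorm]
  rw [hnorm]
  exact Finset.single_le_sum (f := fun i => ‖x i‖ ^ p) (fun i _ => by positivity)
    (Finset.mem_univ i)

/-- The square of the Sobolev norm of order `k` at frequency scale `a`. -/
def sobolevSq (k : ℕ) (a : ℝ) (f : (Fin d → ℝ) → ℂ) : ℝ :=
  a ^ (2 * k) * meanSq f + ∑ i, meanSq ((dirDeriv i)^[k] f)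

theorem summable_and_tsum_sq_weighted_fourierCoeff_le (hk : k ≠ 0) (hf : TorusPeriodic f)
    (hc : ContDiff ℝ k f) {a : ℝ} (ha : 0 ≤ a) :
    (Summable fun n => ((a + ‖n‖) ^ k * ‖fourierCoeff f n‖) ^ 2) ∧
      ∑' n, ((a + ‖n‖) ^ k * ‖fourierCoeff f n‖) ^ 2 ≤ 2 ^ (2 * k) * sobolevSq k a f := by
  have hderiv (i : Fin d) : HasSum (fun n => ‖fourierCoeff ((dirDeriv i)^[k] f) n‖ ^ 2)
      (meanSq ((dirDeriv i)^[k] f)) :=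
    hasSum_sq_fourierCoeff (hf.iterate_dirDeriv i k)
      (contDiff_iterate_dirDeriv (N := 0) (by simpa using hc) i).continuous
  have hparseval := (((hasSum_sq_fourierCoeff hf hc.continuous).mul_left (a ^ (2 * k))).add
    (hasSum_sum (s := Finset.univ) fun i _ => hderiv i)).mul_left (2 ^ (2 * k))
  have hle (n : Fin d → ℤ) : ((a + ‖n‖) ^ k * ‖fourierCoeff f n‖) ^ 2 ≤
      2 ^ (2 * k) * (a ^ (2 * k) * ‖fourierCoeff f n‖ ^ 2 +
        ∑ i, ‖fourierCoeff ((dirDeriv i)^[k] f) n‖ ^ 2) := by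
    simp_rw [sq_norm_fourierCoeff_iterate_dirDeriv hf hc, ← Finset.sum_mul, ← add_mul]
    rw [mul_pow, ← pow_mul, mul_comm k 2, ← mul_assoc]
    refine mul_le_mul_of_nonneg_right ?_ (sq_nonneg _)
    calc (a + ‖n‖) ^ (2 * k) ≤ 2 ^ (2 * k - 1) * (a ^ (2 * k) + ‖n‖ ^ (2 * k)) :=
          add_pow_le ha (norm_nonneg n) _
      _ ≤ 2 ^ (2 * k) * (a ^ (2 * k) + ∑ i, ‖n i‖ ^ (2 * k)) := by
          gcongr
          exacts [one_le_two, Nat.sub_le _ _, pi_norm_pow_le_sum (by omega) n]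
  have hsummable := Summable.of_nonneg_of_le (fun _ => sq_nonneg _) hle hparseval.summable
  exact ⟨hsummable,
    (hsummable.tsum_le_tsum hle hparseval.summable).trans_eq hparseval.tsum_eq⟩

-- Cauchy–Schwarz against the weights `(a + ‖n‖) ^ k`.
theorem summable_and_sq_wienerNorm_le (hk : d < 2 * k) (hf : TorusPeriodic f)
    (hc : ContDiff ℝ k f) {a : ℝ} (ha : 1 ≤ a) :
    (Summable fun n => ‖fourierCoeff f n‖) ∧ wienerNorm f ^ 2 ≤
      (∑' n : Fin d → ℤ, ((a + ‖n‖) ^ (2 * k))⁻¹) * (2 ^ (2 * k) * sobolevSq k a f) := by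
  obtain ⟨hweighted, hsobolev⟩ :=
    summable_and_tsum_sq_weighted_fourierCoeff_le (by omega) hf hc (zero_le_one.trans ha)
  have hweight (n : Fin d → ℤ) : ((a + ‖n‖) ^ (2 * k))⁻¹ = ((a + ‖n‖) ^ k)⁻¹ ^ 2 := by
    rw [inv_pow, ← pow_mul, mul_comm k 2]
  have hpos (n : Fin d → ℤ) : 0 < (a + ‖n‖) ^ k := by positivity
  have hcancel (n : Fin d → ℤ) : ((a + ‖n‖) ^ k)⁻¹ * ((a + ‖n‖) ^ k * ‖fourierCoeff f n‖) =
      ‖fourierCoeff f n‖ := inv_mul_cancel_left₀ (hpos n).ne' _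
  obtain ⟨hsummable, hcs⟩ := summable_mul_and_sq_tsum_le (fun n => (inv_pos.2 (hpos n)).le)
    (fun n => mul_nonneg (hpos n).le (norm_nonneg (fourierCoeff f n)))
    ((summable_inv_add_norm_pow hk ha).congr hweight) hweighted
  simp only [hcancel, ← hweight] at hsummable hcs
  exact ⟨hsummable, hcs.trans
    (mul_le_mul_of_nonneg_left hsobolev (tsum_nonneg fun n => by positivity))⟩

theorem memWiener_of_contDiff (hk : d < 2 * k) (hf : TorusPeriodic f) (hc : ContDiff ℝ k f) :
    MemWiener f :=
  ⟨hf, hc.continuous, (summable_and_sq_wienerNorm_le hk hf hc le_rfl).1⟩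

end Sobolev

section GaussianBounds

variable {d k : ℕ} {f : (Fin d → ℝ) → ℂ} {a B κ : ℝ}

theorem integrable_exp_neg_mul_sum_sq (d : ℕ) (hκ : 0 < κ) :
    Integrable fun ξ : Fin d → ℝ => Real.exp (-κ * ∑ i, ξ i ^ 2) := by
  simp_rw [Finset.mul_sum, Real.exp_sum]
  exact Integrable.fintype_prod fun _ => integrable_exp_neg_mul_sq hκ

theorem integral_exp_neg_mul_sum_sq (d : ℕ) (κ : ℝ) :
    ∫ ξ : Fin d → ℝ, Real.exp (-κ * ∑ i, ξ i ^ 2) = √(π / κ) ^ d := by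
  simp_rw [Finset.mul_sum, Real.exp_sum]
  rw [integral_fintype_prod_volume_eq_prod (f := fun _ x => Real.exp (-κ * x ^ 2))]
  simp only [integral_gaussian, Finset.prod_const, Finset.card_univ, Fintype.card_fin]

theorem setIntegral_sq_norm_le (hκ : 0 < κ) {s : Set (Fin d → ℝ)} (hs : MeasurableSet s)
    (hf : ∀ ξ ∈ s, ‖f ξ‖ ≤ B * Real.exp (-(κ * ∑ i, ξ i ^ 2))) :
    ∫ ξ in s, ‖f ξ‖ ^ 2 ≤ B ^ 2 * √(π / (2 * κ)) ^ d := by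
  have hgauss := (integrable_exp_neg_mul_sum_sq d (κ := 2 * κ) (by positivity)).const_mul (B ^ 2)
  have hpoint : ∀ ξ ∈ s, ‖f ξ‖ ^ 2 ≤ B ^ 2 * Real.exp (-(2 * κ) * ∑ i, ξ i ^ 2) := by
    intro ξ hξ
    calc ‖f ξ‖ ^ 2 ≤ (B * Real.exp (-(κ * ∑ i, ξ i ^ 2))) ^ 2 := by gcongr; exact hf ξ hξ
      _ = B ^ 2 * Real.exp (-(2 * κ) * ∑ i, ξ i ^ 2) := by
          rw [mul_pow, sq (Real.exp _), ← Real.exp_add]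
          ring_nf
  calc ∫ ξ in s, ‖f ξ‖ ^ 2 ≤ ∫ ξ in s, B ^ 2 * Real.exp (-(2 * κ) * ∑ i, ξ i ^ 2) :=
        integral_mono_of_nonneg (.of_forall fun _ => sq_nonneg _) hgauss.integrableOn
          (ae_restrict_of_forall_mem hs hpoint)
    _ ≤ ∫ ξ : Fin d → ℝ, B ^ 2 * Real.exp (-(2 * κ) * ∑ i, ξ i ^ 2) :=
        setIntegral_le_integral hgauss
          (.of_forall fun _ => mul_nonneg (sq_nonneg _) (Real.exp_pos _).le)
    _ = B ^ 2 * √(π / (2 * κ)) ^ d := by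
        rw [integral_const_mul, integral_exp_neg_mul_sum_sq]

theorem meanSq_le_of_norm_le (hκ : 0 < κ)
    (hf : ∀ ξ, ‖ξ‖ ≤ π → ‖f ξ‖ ≤ B * Real.exp (-(κ * ∑ i, ξ i ^ 2))) :
    meanSq f ≤ B ^ 2 * √κ⁻¹ ^ d := by
  have hint := setIntegral_sq_norm_le (s := Set.Icc (fun _ => -π) (fun _ => π)) hκ
    measurableSet_Icc fun ξ hξ =>
      hf ξ ((pi_norm_le_iff_of_nonneg Real.pi_pos.le).2 fun i => abs_le.2 ⟨hξ.1 i, hξ.2 i⟩)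
  have hscale : √(π / (2 * κ)) / (2 * π) ≤ √κ⁻¹ := by
    rw [div_le_iff₀ (by positivity), Real.sqrt_le_iff]
    refine ⟨by positivity, ?_⟩
    rw [mul_pow, Real.sq_sqrt (by positivity), show π / (2 * κ) = κ⁻¹ * (π / 2) by field_simp]
    gcongr
    nlinarith [Real.pi_gt_three]
  calc meanSq f ≤ ((2 * π) ^ d)⁻¹ * (B ^ 2 * √(π / (2 * κ)) ^ d) := by rw [meanSq]; gcongr
    _ = B ^ 2 * (√(π / (2 * κ)) / (2 * π)) ^ d := by rw [div_pow]; ring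
    _ ≤ B ^ 2 * √κ⁻¹ ^ d := by gcongr

/-- On the period cube `[-π,π]^d`, the derivatives of `f` up to order `k` are dominated by those of
a Gaussian of height `B` and rate `κ` modulated at frequency `a`. -/
def GaussianBound (k : ℕ) (a B κ : ℝ) (f : (Fin d → ℝ) → ℂ) : Prop :=
  ∀ ξ, ‖ξ‖ ≤ π → DerivBound k a (B * Real.exp (-(κ * ∑ i, ξ i ^ 2))) f ξ

theorem GaussianBound.mono {b : ℝ} (hf : GaussianBound k a B κ f) (ha : 0 ≤ a) (hab : a ≤ b)
    (hB : 0 ≤ B) : GaussianBound k b B κ f :=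
  fun ξ hξ => (hf ξ hξ).mono ha hab (by positivity) le_rfl

theorem GaussianBound.sobolevSq_le (hf : GaussianBound k a B κ f) (hc : ContDiff ℝ k f)
    (ha : 0 ≤ a) (hκ : 0 < κ) :
    sobolevSq k a f ≤ (1 + d) * (a ^ (2 * k) * (B ^ 2 * √κ⁻¹ ^ d)) := by
  have hvalue : meanSq f ≤ B ^ 2 * √κ⁻¹ ^ d :=
    meanSq_le_of_norm_le hκ fun ξ hξ => (hf ξ hξ).norm_le
  have hderiv (i : Fin d) : meanSq ((dirDeriv i)^[k] f) ≤ (B * a ^ k) ^ 2 * √κ⁻¹ ^ d :=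
    meanSq_le_of_norm_le hκ fun ξ hξ => (norm_iterate_dirDeriv_le hc i ξ).trans
      ((hf ξ hξ k le_rfl).trans_eq (by ring))
  calc sobolevSq k a f
      ≤ a ^ (2 * k) * (B ^ 2 * √κ⁻¹ ^ d) + ∑ _i : Fin d, (B * a ^ k) ^ 2 * √κ⁻¹ ^ d := by
        rw [sobolevSq]
        gcongr with i
        exact hderiv i
    _ = (1 + d) * (a ^ (2 * k) * (B ^ 2 * √κ⁻¹ ^ d)) := by
        rw [Finset.sum_const, Finset.card_univ, Fintype.card_fin, nsmul_eq_mul]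
        ring

theorem exists_wienerNorm_le_of_gaussianBound (hk : d < 2 * k) :
    ∃ C : ℝ, 0 < C ∧ ∀ (f : (Fin d → ℝ) → ℂ) (a B κ : ℝ), TorusPeriodic f → ContDiff ℝ k f →
      1 ≤ a → 0 ≤ B → 0 < κ → GaussianBound k a B κ f →
      wienerNorm f ≤ C * B * √((a / √κ) ^ d) := by
  obtain ⟨C, hC, hlattice⟩ := exists_tsum_inv_add_norm_pow_le hk
  set C' := C * 2 ^ (2 * k) * (1 + d)
  refine ⟨√C' + 1, by positivity, fun f a B κ hf hc ha hB hκ hG => ?_⟩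
  have hsq : wienerNorm f ^ 2 ≤ C' * B ^ 2 * (a / √κ) ^ d :=
    calc wienerNorm f ^ 2
        ≤ (∑' n : Fin d → ℤ, ((a + ‖n‖) ^ (2 * k))⁻¹) * (2 ^ (2 * k) * sobolevSq k a f) :=
          (summable_and_sq_wienerNorm_le hk hf hc ha).2
      _ ≤ (C * (a ^ d * (a ^ (2 * k))⁻¹)) *
            (2 ^ (2 * k) * ((1 + d) * (a ^ (2 * k) * (B ^ 2 * √κ⁻¹ ^ d)))) := by
          have hsobolev := hG.sobolevSq_le hc (by linarith) hκ
          exact mul_le_mul (hlattice a ha) (by gcongr)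
            (by rw [sobolevSq]; unfold meanSq; positivity) (by positivity)
      _ = C' * B ^ 2 * (a / √κ) ^ d := by
          rw [Real.sqrt_inv, div_pow, inv_pow]
          field_simp
          simp only [C']
          ring
  calc wienerNorm f = √(wienerNorm f ^ 2) := (Real.sqrt_sq (wienerNorm_nonneg f)).symm
    _ ≤ √(C' * B ^ 2 * (a / √κ) ^ d) := Real.sqrt_le_sqrt hsq
    _ = √C' * B * √((a / √κ) ^ d) := by
        rw [Real.sqrt_mul (by positivity), Real.sqrt_mul (by positivity), Real.sqrt_sq hB]
    _ ≤ (√C' + 1) * B * √((a / √κ) ^ d) := by gcongr; linarith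

end GaussianBounds

section MeanOfUnitVectors

variable {Ω E : Type*} [MeasurableSpace Ω] {μ : Measure Ω} [IsProbabilityMeasure μ]
  [NormedAddCommGroup E] {u : Ω → E}

theorem integrable_sq_norm_sub (hu : AEStronglyMeasurable u μ) (hnorm : ∀ ω, ‖u ω‖ = 1)
    {ζ : E} (hζ : ‖ζ‖ = 1) : Integrable (fun ω => ‖u ω - ζ‖ ^ 2) μ := by
  refine .of_bound ((hu.sub aestronglyMeasurable_const).norm.pow 2) (2 ^ 2) (.of_forall fun ω => ?_)
  rw [norm_pow, norm_norm]
  gcongr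
  calc ‖u ω - ζ‖ ≤ ‖u ω‖ + ‖ζ‖ := norm_sub_le _ _
    _ = 2 := by rw [hnorm, hζ]; norm_num

variable [InnerProductSpace ℝ E] [CompleteSpace E]

theorem exists_integral_sq_norm_sub_eq (hu : AEStronglyMeasurable u μ) (hnorm : ∀ ω, ‖u ω‖ = 1) :
    ∃ ζ : E, ‖ζ‖ = 1 ∧ ‖∫ ω, u ω ∂μ‖ • ζ = ∫ ω, u ω ∂μ ∧
      ∫ ω, ‖u ω - ζ‖ ^ 2 ∂μ = 2 * (1 - ‖∫ ω, u ω ∂μ‖) := by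
  obtain ⟨ζ, hζ, hmean⟩ : ∃ ζ : E, ‖ζ‖ = 1 ∧ ‖∫ ω, u ω ∂μ‖ • ζ = ∫ ω, u ω ∂μ := by
    rcases eq_or_ne (∫ ω, u ω ∂μ) 0 with h0 | h0
    · obtain ⟨ω⟩ := nonempty_of_isProbabilityMeasure μ
      exact ⟨u ω, hnorm ω, by rw [h0, norm_zero, zero_smul]⟩
    · exact ⟨_, norm_smul_inv_norm (𝕜 := ℝ) h0, smul_inv_smul₀ (norm_ne_zero_iff.2 h0) _⟩
  have hint : Integrable u μ := .of_bound hu 1 (.of_forall fun ω => (hnorm ω).le)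
  refine ⟨ζ, hζ, hmean, ?_⟩
  calc ∫ ω, ‖u ω - ζ‖ ^ 2 ∂μ = ∫ ω, 2 * (1 - inner ℝ ζ (u ω)) ∂μ := by
        refine integral_congr_ae (.of_forall fun ω => ?_)
        simp only [norm_sub_sq_real, hnorm, hζ, real_inner_comm ζ]
        ring
    _ = 2 * (1 - inner ℝ ζ (∫ ω, u ω ∂μ)) := by
        rw [integral_const_mul, integral_sub (integrable_const _) (hint.const_inner ζ),
          integral_const, probReal_univ, one_smul, integral_inner hint]
    _ = 2 * (1 - ‖∫ ω, u ω ∂μ‖) := by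
        conv_lhs => rw [← hmean]
        rw [real_inner_smul_right, real_inner_self_eq_norm_sq, hζ, one_pow, mul_one]

theorem ae_eq_integral_of_norm_integral_eq_one (hu : AEStronglyMeasurable u μ)
    (hnorm : ∀ ω, ‖u ω‖ = 1) (h : ‖∫ ω, u ω ∂μ‖ = 1) : ∀ᵐ ω ∂μ, u ω = ∫ ω, u ω ∂μ := by
  obtain ⟨ζ, hζ, hmean, hvar⟩ := exists_integral_sq_norm_sub_eq hu hnorm
  rw [h, sub_self, mul_zero, integral_eq_zero_iff_of_nonneg (fun _ => sq_nonneg _)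
    (integrable_sq_norm_sub hu hnorm hζ)] at hvar
  rw [h, one_smul] at hmean
  filter_upwards [hvar] with ω hω
  rwa [Pi.zero_apply, sq_eq_zero_iff, norm_eq_zero, sub_eq_zero, hmean] at hω

theorem min_measureReal_mul_sq_norm_sub_le [MeasurableSingletonClass Ω]
    (hu : AEStronglyMeasurable u μ) (hnorm : ∀ ω, ‖u ω‖ = 1) {x y : Ω} (hxy : x ≠ y) :
    min (μ.real {x}) (μ.real {y}) / 4 * ‖u x - u y‖ ^ 2 ≤ 1 - ‖∫ ω, u ω ∂μ‖ := by
  classical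
  obtain ⟨ζ, hζ, -, hvar⟩ := exists_integral_sq_norm_sub_eq hu hnorm
  have hint := integrable_sq_norm_sub hu hnorm hζ
  have hatoms : μ.real {x} * ‖u x - ζ‖ ^ 2 + μ.real {y} * ‖u y - ζ‖ ^ 2 ≤
      2 * (1 - ‖∫ ω, u ω ∂μ‖) :=
    calc μ.real {x} * ‖u x - ζ‖ ^ 2 + μ.real {y} * ‖u y - ζ‖ ^ 2
        = ∫ ω in (({x, y} : Finset Ω) : Set Ω), ‖u ω - ζ‖ ^ 2 ∂μ := by
          rw [setIntegral_finset _ hint.integrableOn, Finset.sum_pair hxy, smul_eq_mul, smul_eq_mul]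
      _ ≤ ∫ ω, ‖u ω - ζ‖ ^ 2 ∂μ := setIntegral_le_integral hint (.of_forall fun _ => sq_nonneg _)
      _ = 2 * (1 - ‖∫ ω, u ω ∂μ‖) := hvar
  have htriangle : ‖u x - u y‖ ^ 2 ≤ 2 * (‖u x - ζ‖ ^ 2 + ‖u y - ζ‖ ^ 2) :=
    calc ‖u x - u y‖ ^ 2 ≤ (‖u x - ζ‖ + ‖u y - ζ‖) ^ 2 := by
          gcongr
          rw [← sub_sub_sub_cancel_right (u x) (u y) ζ]
          exact norm_sub_le _ _
      _ ≤ 2 * (‖u x - ζ‖ ^ 2 + ‖u y - ζ‖ ^ 2) := add_sq_le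
  have hleft : min (μ.real {x}) (μ.real {y}) * ‖u x - ζ‖ ^ 2 ≤ μ.real {x} * ‖u x - ζ‖ ^ 2 := by
    gcongr; exact min_le_left _ _
  have hright : min (μ.real {x}) (μ.real {y}) * ‖u y - ζ‖ ^ 2 ≤ μ.real {y} * ‖u y - ζ‖ ^ 2 := by
    gcongr; exact min_le_right _ _
  have hmin : 0 ≤ min (μ.real {x}) (μ.real {y}) := le_min measureReal_nonneg measureReal_nonneg
  nlinarith [mul_le_mul_of_nonneg_left htriangle hmin]

end MeanOfUnitVectors

section CharacteristicFunction

variable {ρ : Measure ℤ}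

theorem norm_exp_I_mul_mul (k : ℤ) (θ : ℝ) : ‖Complex.exp (Complex.I * k * θ)‖ = 1 := by
  rw [mul_assoc, ← Complex.norm_exp_I_mul_ofReal (k * θ)]
  push_cast
  rfl

theorem aestronglyMeasurable_exp_I_mul_mul (ρ : Measure ℤ) (θ : ℝ) :
    AEStronglyMeasurable (fun k : ℤ => Complex.exp (Complex.I * k * θ)) ρ :=
  (measurable_of_countable _).aestronglyMeasurable

theorem fourierInt_eq_charFun (ρ : Measure ℤ) :
    fourierInt ρ = charFun (ρ.map fun k : ℤ => (k : ℝ)) := by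
  ext θ
  rw [charFun_apply_real, integral_map (measurable_of_countable _).aemeasurable (by fun_prop),
    fourierInt]
  refine integral_congr_ae (.of_forall fun k => ?_)
  simp only
  push_cast
  ring_nf

theorem HasMoment.memLp {N : ℕ} (h : HasMoment N ρ) : MemLp (fun k : ℤ => (k : ℝ)) N ρ := by
  have hmeas : AEStronglyMeasurable (fun k : ℤ => (k : ℝ)) ρ :=
    (measurable_of_countable _).aestronglyMeasurable
  rcases eq_or_ne N 0 with rfl | hN
  · exact_mod_cast memLp_zero_iff_aestronglyMeasurable.2 hmeas
  · rw [← integrable_norm_rpow_iff hmeas (by exact_mod_cast hN) (by simp)]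
    exact h.congr (.of_forall fun k => by simp)

theorem contDiff_fourierInt [IsFiniteMeasure ρ] {N : ℕ} (h : HasMoment N ρ) :
    ContDiff ℝ N (fourierInt ρ) := by
  rw [fourierInt_eq_charFun]
  refine contDiff_charFun ?_
  rw [memLp_map_measure_iff aestronglyMeasurable_id (measurable_of_countable _).aemeasurable]
  exact h.memLp

theorem norm_fourierInt_le_one (ρ : Measure ℤ) [IsProbabilityMeasure ρ] (θ : ℝ) :
    ‖fourierInt ρ θ‖ ≤ 1 := by
  have := Measure.isProbabilityMeasure_map (μ := ρ) (f := fun k : ℤ => (k : ℝ))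
    (measurable_of_countable _).aemeasurable
  rw [fourierInt_eq_charFun]
  exact norm_charFun_le_one θ

variable [IsProbabilityMeasure ρ] {θ : ℝ}

theorem ae_exp_eq_fourierInt (h : ‖fourierInt ρ θ‖ = 1) :
    ∀ᵐ k : ℤ ∂ρ, Complex.exp (Complex.I * k * θ) = fourierInt ρ θ :=
  ae_eq_integral_of_norm_integral_eq_one (aestronglyMeasurable_exp_I_mul_mul ρ θ)
    (fun k => norm_exp_I_mul_mul k θ) h

theorem fourierInt_nat_mul (h : ‖fourierInt ρ θ‖ = 1) (j : ℕ) :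
    fourierInt ρ (j * θ) = fourierInt ρ θ ^ j := by
  have hae : (fun k : ℤ => Complex.exp (Complex.I * k * (j * θ : ℝ))) =ᵐ[ρ]
      fun _ => fourierInt ρ θ ^ j := by
    filter_upwards [ae_exp_eq_fourierInt h] with k hk
    rw [← hk, ← Complex.exp_nat_mul]
    push_cast
    ring_nf
  rw [fourierInt, integral_congr_ae hae, integral_const, probReal_univ, one_smul]

theorem two_div_pi_mul_abs_le_norm_exp_sub_one {x : ℝ} (hx : |x| ≤ π) :
    2 / π * |x| ≤ ‖Complex.exp (Complex.I * x) - 1‖ := by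
  have hhalf : |x / 2| = |x| / 2 := by rw [abs_div, abs_two]
  rw [Complex.norm_exp_I_mul_ofReal_sub_one, norm_mul, Real.norm_two, Real.norm_eq_abs]
  calc 2 / π * |x| = 2 * (2 / π * |x / 2|) := by rw [hhalf]; ring
    _ ≤ 2 * |Real.sin (x / 2)| := by
        gcongr
        exact Real.mul_abs_le_abs_sin (by rw [hhalf]; linarith)

theorem two_div_pi_mul_abs_le_norm_exp_sub_exp {k l : ℤ} (hkl : k ≠ l)
    (hθ : |((k - l : ℤ) : ℝ) * θ| ≤ π) :
    2 / π * |θ| ≤ ‖Complex.exp (Complex.I * k * θ) - Complex.exp (Complex.I * l * θ)‖ := by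
  have hone : (1 : ℝ) ≤ |((k - l : ℤ) : ℝ)| := by
    exact_mod_cast Int.one_le_abs (sub_ne_zero.2 hkl)
  have hfactor : Complex.exp (Complex.I * k * θ) - Complex.exp (Complex.I * l * θ) =
      Complex.exp (Complex.I * l * θ) *
        (Complex.exp (Complex.I * (((k - l : ℤ) * θ : ℝ) : ℂ)) - 1) := by
    rw [mul_sub, ← Complex.exp_add, mul_one]
    push_cast
    ring_nf
  rw [hfactor, norm_mul, norm_exp_I_mul_mul, one_mul]
  refine le_trans ?_ (two_div_pi_mul_abs_le_norm_exp_sub_one hθ)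
  rw [abs_mul]
  gcongr
  exact le_mul_of_one_le_left (abs_nonneg θ) hone

theorem mul_sq_le_one_sub_norm_fourierInt {k l : ℤ} (hkl : k ≠ l)
    (hθ : |((k - l : ℤ) : ℝ) * θ| ≤ π) :
    min (ρ.real {k}) (ρ.real {l}) / π ^ 2 * θ ^ 2 ≤ 1 - ‖fourierInt ρ θ‖ :=
  calc min (ρ.real {k}) (ρ.real {l}) / π ^ 2 * θ ^ 2
      = min (ρ.real {k}) (ρ.real {l}) / 4 * (2 / π * |θ|) ^ 2 := by
        rw [mul_pow, sq_abs]
        field_simp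
        norm_num
    _ ≤ min (ρ.real {k}) (ρ.real {l}) / 4 *
          ‖Complex.exp (Complex.I * k * θ) - Complex.exp (Complex.I * l * θ)‖ ^ 2 := by
        gcongr
        exact two_div_pi_mul_abs_le_norm_exp_sub_exp hkl hθ
    _ ≤ 1 - ‖fourierInt ρ θ‖ :=
        min_measureReal_mul_sq_norm_sub_le (aestronglyMeasurable_exp_I_mul_mul ρ θ)
          (fun k => norm_exp_I_mul_mul k θ) hkl

theorem exists_ne_atoms_of_norm_fourierInt_lt_one (h : ‖fourierInt ρ θ‖ < 1) :
    ∃ k l : ℤ, k ≠ l ∧ 0 < ρ.real {k} ∧ 0 < ρ.real {l} := by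
  by_contra! hcon
  have hunique (k l : ℤ) (hk : ρ {k} ≠ 0) (hl : ρ {l} ≠ 0) : k = l := by
    by_contra hkl
    exact (hcon k l hkl (ENNReal.toReal_pos hk (measure_ne_top _ _))).not_gt
      (ENNReal.toReal_pos hl (measure_ne_top _ _))
  obtain ⟨k, hk⟩ : ∃ k : ℤ, ρ {k} ≠ 0 := by
    by_contra! hnull
    have hfalse : ∀ᵐ _ : ℤ ∂ρ, False := ae_iff_of_countable.2 fun k hk => hk (hnull k)
    simp [ae_iff] at hfalse
  have hae : (fun l : ℤ => Complex.exp (Complex.I * l * θ)) =ᵐ[ρ]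
      fun _ => Complex.exp (Complex.I * k * θ) :=
    ae_iff_of_countable.2 fun l hl => by rw [hunique l k hl hk]
  rw [fourierInt, integral_congr_ae hae, integral_const, probReal_univ, one_smul,
    norm_exp_I_mul_mul] at h
  exact lt_irrefl 1 h

end CharacteristicFunction

section LevyExponent

theorem contDiff_of_contDiff_exp {E : Type*} [NormedAddCommGroup E] [NormedSpace ℝ E] {φ : E → ℂ}
    {N : WithTop ℕ∞} (hφ : Continuous φ) (h : ContDiff ℝ N fun θ => Complex.exp (φ θ)) :
    ContDiff ℝ N φ := by
  rw [contDiff_iff_contDiffAt]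
  intro θ₀
  have hlog : ContDiffAt ℝ N
      (fun θ => φ θ₀ + Complex.log (Complex.exp (φ θ) * Complex.exp (-φ θ₀))) θ₀ := by
    refine contDiffAt_const.add (ContDiffAt.comp θ₀ (g := Complex.log)
      ((Complex.contDiffAt_log ?_).restrict_scalars ℝ) (h.contDiffAt.mul contDiffAt_const))
    rw [← Complex.exp_add, add_neg_cancel, Complex.exp_zero]
    exact Complex.one_mem_slitPlane
  refine hlog.congr_of_eventuallyEq ?_
  filter_upwards [Metric.continuous_iff'.1 hφ θ₀ 1 one_pos] with θ hθ
  rw [dist_eq_norm] at hθ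
  obtain ⟨hlow, hhigh⟩ := abs_lt.1 ((Complex.abs_im_le_norm (φ θ - φ θ₀)).trans_lt hθ)
  rw [← Complex.exp_add, ← sub_eq_add_neg, Complex.log_exp (by linarith [Real.pi_gt_three])
    (by linarith [Real.pi_gt_three]), add_sub_cancel]

theorem eq_zero_of_exp_eq_one_of_norm_lt_one {z : ℂ} (hexp : Complex.exp z = 1) (hz : ‖z‖ < 1) :
    z = 0 := by
  obtain ⟨hlow, hhigh⟩ := abs_lt.1 ((Complex.abs_im_le_norm z).trans_lt hz)
  exact Complex.exp_inj_of_neg_pi_lt_of_le_pi (by linarith [Real.pi_gt_three])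
    (by linarith [Real.pi_gt_three]) (by simpa using Real.pi_pos) (by simpa using Real.pi_pos.le)
    (by rw [hexp, Complex.exp_zero])

namespace IsLevyExponent

variable {ρ : Measure ℤ} {φ : ℝ → ℂ} {θ : ℝ}

theorem norm_fourierInt (h : IsLevyExponent ρ φ) (θ : ℝ) :
    ‖fourierInt ρ θ‖ = Real.exp (φ θ).re := by
  rw [h.fourier_eq, Complex.norm_exp]

theorem exists_norm_le (h : IsLevyExponent ρ φ) : ∃ B, ∀ θ, ‖φ θ‖ ≤ B := by
  obtain ⟨B, hB⟩ := isBounded_iff_forall_norm_le.1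
    (h.periodic.isBounded_of_continuous (by positivity) h.continuous)
  exact ⟨B, fun θ => hB _ ⟨θ, rfl⟩⟩

-- The characteristic function `exp (φ / n)` of a large convolution root determines `φ` without
-- any `2πi` ambiguity.
theorem apply_nat_mul (h : IsLevyExponent ρ φ) (hθ : (φ θ).re = 0) (j : ℕ) :
    φ (j * θ) = j * φ θ := by
  obtain ⟨n, hn⟩ := exists_nat_gt ‖φ (j * θ) - j * φ θ‖
  have hn0 : (0 : ℝ) < n := (norm_nonneg _).trans_lt hn
  have hn0' : (n : ℂ) ≠ 0 := by exact_mod_cast hn0.ne'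
  obtain ⟨ρn, hprob, hρn⟩ := h.divisible n (by exact_mod_cast hn0)
  have hnorm : ‖fourierInt ρn θ‖ = 1 := by
    rw [hρn, Complex.norm_exp, Complex.div_natCast_re, hθ, zero_div, Real.exp_zero]
  have hexp : Complex.exp ((φ (j * θ) - j * φ θ) / n) = 1 := by
    have hpow := fourierInt_nat_mul hnorm j
    rw [hρn, hρn, ← Complex.exp_nat_mul] at hpow
    rw [sub_div, Complex.exp_sub, hpow, mul_div_assoc, div_self (Complex.exp_ne_zero _)]
  have hsmall : ‖(φ (j * θ) - j * φ θ) / n‖ < 1 := by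
    rwa [norm_div, Complex.norm_natCast, div_lt_one hn0]
  have hzero := eq_zero_of_exp_eq_one_of_norm_lt_one hexp hsmall
  rwa [div_eq_zero_iff, or_iff_left hn0', sub_eq_zero] at hzero

theorem eq_zero_of_re_eq_zero (h : IsLevyExponent ρ φ) (hθ : (φ θ).re = 0) : φ θ = 0 := by
  obtain ⟨B, hB⟩ := h.exists_norm_le
  by_contra hne
  have hpos : 0 < ‖φ θ‖ := norm_pos_iff.2 hne
  obtain ⟨j, hj⟩ := exists_nat_gt (B / ‖φ θ‖)
  rw [div_lt_iff₀ hpos] at hj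
  have hle := hB (j * θ)
  rw [h.apply_nat_mul hθ, norm_mul, Complex.norm_natCast] at hle
  linarith

variable [IsProbabilityMeasure ρ]

theorem contDiff (h : IsLevyExponent ρ φ) {N : ℕ} (hN : HasMoment N ρ) : ContDiff ℝ N φ :=
  contDiff_of_contDiff_exp h.continuous (funext h.fourier_eq ▸ contDiff_fourierInt hN)

theorem re_nonpos (h : IsLevyExponent ρ φ) (θ : ℝ) : (φ θ).re ≤ 0 := by
  rw [← Real.exp_le_one_iff, ← h.norm_fourierInt]
  exact norm_fourierInt_le_one ρ θ

theorem re_neg (h : IsLevyExponent ρ φ) (hlattice : HasMinimalLattice ρ) (hθ : |θ| ≤ π)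
    (hθ0 : θ ≠ 0) : (φ θ).re < 0 := by
  refine (h.re_nonpos θ).lt_of_ne fun hre => hθ0 ?_
  have hone : fourierInt ρ θ = 1 := by
    rw [h.fourier_eq, h.eq_zero_of_re_eq_zero hre, Complex.exp_zero]
  let H : AddSubgroup ℤ := (AddSubgroup.zmultiples (2 * π)).comap (zmultiplesHom ℝ θ)
  have hmem (k : ℤ) : k ∈ H ↔ Complex.exp (Complex.I * k * θ) = 1 := by
    simp only [H, AddSubgroup.mem_comap, zmultiplesHom_apply, AddSubgroup.mem_zmultiples_iff,
      zsmul_eq_mul, Complex.exp_eq_one_iff, mul_assoc]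
    refine exists_congr fun n => ?_
    rw [eq_comm, show (n : ℂ) * (2 * (π * Complex.I)) = Complex.I * (n * (2 * π)) by ring,
      mul_right_inj' Complex.I_ne_zero]
    norm_cast
  have htop : H = ⊤ := by
    refine hlattice H (ae_iff.1 (?_ : ∀ᵐ k ∂ρ, k ∈ H))
    filter_upwards [ae_exp_eq_fourierInt (ρ := ρ) (θ := θ) (by rw [hone, norm_one])] with k hk
    rw [hmem, hk, hone]
  have hexp : Complex.exp (Complex.I * θ) = 1 := by
    simpa using (hmem 1).1 (htop ▸ AddSubgroup.mem_top 1)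
  have hchord := two_div_pi_mul_abs_le_norm_exp_sub_one hθ
  rw [hexp, sub_self, norm_zero] at hchord
  exact abs_nonpos_iff.1 (nonpos_of_mul_nonpos_right hchord (by positivity))

theorem exists_re_le_near_zero (h : IsLevyExponent ρ φ) (hlattice : HasMinimalLattice ρ) :
    ∃ c δ : ℝ, 0 < c ∧ 0 < δ ∧ ∀ θ : ℝ, |θ| ≤ δ → (φ θ).re ≤ -(c * θ ^ 2) := by
  have hlt : ‖fourierInt ρ 1‖ < 1 := by
    rw [h.norm_fourierInt, Real.exp_lt_one_iff]
    exact h.re_neg hlattice (by rw [abs_one]; linarith [Real.pi_gt_three]) one_ne_zero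
  obtain ⟨k, l, hkl, hk, hl⟩ := exists_ne_atoms_of_norm_fourierInt_lt_one hlt
  have hpos : 0 < |((k - l : ℤ) : ℝ)| := abs_pos.2 (by exact_mod_cast sub_ne_zero.2 hkl)
  have hmin : 0 < min (ρ.real {k}) (ρ.real {l}) := lt_min hk hl
  refine ⟨min (ρ.real {k}) (ρ.real {l}) / π ^ 2, π / |((k - l : ℤ) : ℝ)|, by positivity,
    by positivity, fun θ hθ => ?_⟩
  have hdefect := mul_sq_le_one_sub_norm_fourierInt (ρ := ρ) hkl
    (by rwa [abs_mul, ← le_div_iff₀' hpos])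
  rw [h.norm_fourierInt] at hdefect
  linarith [Real.add_one_le_exp (φ θ).re]

end IsLevyExponent

theorem exists_le_neg_mul_sq {g : ℝ → ℝ} {R c δ : ℝ} (hg : Continuous g) (hc : 0 < c)
    (hδ : 0 < δ) (hneg : ∀ θ, |θ| ≤ R → θ ≠ 0 → g θ < 0)
    (hnear : ∀ θ, |θ| ≤ δ → g θ ≤ -(c * θ ^ 2)) :
    ∃ c' : ℝ, 0 < c' ∧ ∀ θ, |θ| ≤ R → g θ ≤ -(c' * θ ^ 2) := by
  have hcompact : IsCompact (Metric.closedBall (0 : ℝ) R \ Metric.ball 0 δ) :=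
    (isCompact_closedBall _ _).diff Metric.isOpen_ball
  have hne (θ : ℝ) (hθ : θ ∈ Metric.closedBall (0 : ℝ) R \ Metric.ball 0 δ) : θ ≠ 0 := by
    rintro rfl
    exact hθ.2 (Metric.mem_ball_self hδ)
  obtain ⟨b, hb, hfar⟩ := hcompact.exists_forall_le' (f := fun θ => -g θ / θ ^ 2) (a := 0)
    (hg.neg.continuousOn.div (by fun_prop) fun θ hθ => pow_ne_zero 2 (hne θ hθ))
    fun θ hθ => div_pos (neg_pos.2 (hneg θ (by simpa using hθ.1) (hne θ hθ)))
      (sq_pos_of_ne_zero (hne θ hθ))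
  refine ⟨min c b, lt_min hc hb, fun θ hθ => ?_⟩
  rcases le_or_gt |θ| δ with h | h
  · refine (hnear θ h).trans (neg_le_neg ?_)
    gcongr
    exact min_le_left _ _
  · have hmem : θ ∈ Metric.closedBall (0 : ℝ) R \ Metric.ball 0 δ :=
      ⟨by simpa using hθ, by simpa using h.le⟩
    have hle := (min_le_right c b).trans (hfar θ hmem)
    rw [le_div_iff₀ (sq_pos_of_ne_zero (hne θ hmem))] at hle
    linarith

variable {d : ℕ} {ρ : Fin d → Measure ℤ} {φ : Fin d → ℝ → ℂ}

theorem re_le_decayM (hprob : ∀ i, IsProbabilityMeasure (ρ i))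
    (hφ : ∀ i, IsLevyExponent (ρ i) (φ i)) (i : Fin d) {θ : ℝ} (hθ : |θ| ≤ π) :
    (φ i θ).re ≤ -(decayM φ * θ ^ 2) := by
  rcases eq_or_ne θ 0 with rfl | hne
  · simp [(hφ i).zero]
  · have hbdd : BddAbove {x : ℝ | ∃ (i : Fin d) (θ : ℝ),
        |θ| ≤ π ∧ θ ≠ 0 ∧ x = (φ i θ).re / θ ^ 2} := by
      refine ⟨0, ?_⟩
      rintro x ⟨i, θ, -, -, rfl⟩
      exact div_nonpos_of_nonpos_of_nonneg ((hφ i).re_nonpos θ) (sq_nonneg θ)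
    have hle := le_csSup hbdd ⟨i, θ, hθ, hne, rfl⟩
    rw [div_le_iff₀ (sq_pos_of_ne_zero hne)] at hle
    rw [decayM]
    linarith

theorem decayM_pos (hd : 1 ≤ d) (hprob : ∀ i, IsProbabilityMeasure (ρ i))
    (hφ : ∀ i, IsLevyExponent (ρ i) (φ i)) (hlattice : ∀ i, HasMinimalLattice (ρ i)) :
    0 < decayM φ := by
  have hdecay (i : Fin d) : ∃ c : ℝ, 0 < c ∧ ∀ θ : ℝ, |θ| ≤ π → (φ i θ).re ≤ -(c * θ ^ 2) := by
    obtain ⟨c, δ, hc, hδ, hnear⟩ := (hφ i).exists_re_le_near_zero (hlattice i)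
    exact exists_le_neg_mul_sq (Complex.continuous_re.comp (hφ i).continuous) hc hδ
      (fun θ => (hφ i).re_neg (hlattice i)) hnear
  choose c hc hre using hdecay
  have : NeZero d := ⟨by omega⟩
  obtain ⟨b, hb, hbc⟩ : ∃ b : ℝ, 0 < b ∧ ∀ i, b ≤ c i :=
    ⟨Finset.univ.inf' Finset.univ_nonempty c, (Finset.lt_inf'_iff _).2 fun i _ => hc i,
      fun i => Finset.inf'_le _ (Finset.mem_univ i)⟩
  rw [decayM, neg_pos]
  refine lt_of_le_of_lt (csSup_le ⟨_, 0, π, (abs_of_pos Real.pi_pos).le, Real.pi_ne_zero, rfl⟩ ?_)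
    (neg_lt_zero.2 hb)
  rintro x ⟨i, θ, hθ, hne, rfl⟩
  rw [div_le_iff₀ (sq_pos_of_ne_zero hne), neg_mul]
  refine (hre i θ hθ).trans (neg_le_neg ?_)
  gcongr
  exact hbc i

end LevyExponent

section Cutoff

variable {d : ℕ} {ε : ℝ} {ξ : Fin d → ℝ}

/-- The smooth bump on `ℝ^d` from which the periodic cutoff functions are built; it equals `1` on
the cube of radius `3/4` and vanishes outside the cube of radius `15/16`. -/
def cutoffProfile (t : Fin d → ℝ) : ℂ :=
  ∏ l, ((Real.smoothTransition ((225 - 256 * t l ^ 2) / 81) : ℝ) : ℂ)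

theorem contDiff_cutoffProfile (N : ℕ) : ContDiff ℝ N (cutoffProfile (d := d)) := by
  refine contDiff_prod fun l _ => Complex.ofRealCLM.contDiff.comp ?_
  refine (Real.smoothTransition.contDiff (n := (N : ℕ∞))).comp ?_
  exact (contDiff_const.sub (contDiff_const.mul ((contDiff_apply ℝ ℝ l).pow 2))).div_const _

theorem cutoffProfile_eq_zero {t : Fin d → ℝ} {l : Fin d} (h : 15 / 16 ≤ |t l|) :
    cutoffProfile t = 0 := by
  refine Finset.prod_eq_zero (Finset.mem_univ l) ?_
  rw [Real.smoothTransition.zero_of_nonpos, Complex.ofReal_zero]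
  have : (15 / 16 : ℝ) ^ 2 ≤ t l ^ 2 := by rw [← sq_abs (t l)]; gcongr
  linarith

theorem cutoffProfile_eq_one {t : Fin d → ℝ} (h : ∀ l, |t l| ≤ 3 / 4) : cutoffProfile t = 1 := by
  refine Finset.prod_eq_one fun l _ => ?_
  rw [Real.smoothTransition.one_of_one_le, Complex.ofReal_one]
  have : t l ^ 2 ≤ (3 / 4 : ℝ) ^ 2 := by rw [← sq_abs (t l)]; gcongr; exact h l
  linarith

theorem hasCompactSupport_cutoffProfile : HasCompactSupport (cutoffProfile (d := d)) := by
  refine HasCompactSupport.intro (isCompact_closedBall 0 1) fun t ht => ?_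
  rw [mem_closedBall_zero_iff, pi_norm_le_iff_of_nonneg zero_le_one] at ht
  push Not at ht
  obtain ⟨l, hl⟩ := ht
  rw [Real.norm_eq_abs] at hl
  exact cutoffProfile_eq_zero (l := l) (by linarith)

/-- The vector of the functions `2 sin (ξ_l / 2)`, whose squares are periodic and which is close to
`ξ` near the origin. -/
def halfSine (ξ : Fin d → ℝ) : Fin d → ℝ := fun l => 2 * Real.sin (ξ l / 2)

theorem contDiff_halfSine (N : WithTop ℕ∞) : ContDiff ℝ N (halfSine (d := d)) :=
  contDiff_pi.2 fun l =>
    contDiff_const.mul (Real.contDiff_sin.comp ((contDiff_apply ℝ ℝ l).div_const 2))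

theorem abs_halfSine_le (ξ : Fin d → ℝ) (l : Fin d) : |halfSine ξ l| ≤ |ξ l| := by
  have hsin : |Real.sin (ξ l / 2)| ≤ |ξ l / 2| := Real.abs_sin_le_abs
  rw [abs_div, abs_two] at hsin
  rw [halfSine, abs_mul, abs_two]
  linarith

theorem lt_abs_halfSine (hε : 0 < ε) (hε1 : ε < 1) {l : Fin d} (hl : ε < |ξ l|)
    (hlπ : |ξ l| ≤ π) : 15 / 16 * ε < |halfSine ξ l| := by
  have hhalf : |ξ l / 2| = |ξ l| / 2 := by rw [abs_div, abs_two]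
  have hcube : ε / 2 - (ε / 2) ^ 3 / 6 < Real.sin (ε / 2) :=
    Real.sin_gt_sub_cube (by positivity)
  have hmono : Real.sin (ε / 2) ≤ Real.sin (|ξ l| / 2) :=
    Real.sin_le_sin_of_le_of_le_pi_div_two (by linarith [Real.pi_pos]) (by linarith) (by linarith)
  rw [halfSine, abs_mul, abs_two,
    Real.abs_sin_eq_sin_abs_of_abs_le_pi (by rw [hhalf]; linarith [Real.pi_pos]), hhalf]
  nlinarith [mul_pos hε hε, mul_pos (mul_pos hε hε) hε]

theorem sq_halfSine_add_single (ξ : Fin d → ℝ) (i l : Fin d) :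
    halfSine (ξ + Pi.single i (2 * π)) l ^ 2 = halfSine ξ l ^ 2 := by
  rcases eq_or_ne l i with rfl | hl
  · simp only [halfSine, Pi.add_apply, Pi.single_eq_same, add_div]
    rw [mul_div_cancel_left₀ _ two_ne_zero, Real.sin_add_pi]
    ring
  · simp [halfSine, hl]

/-- The smooth periodic cutoff to the cube of radius `ε` about the origin. -/
def cutoff (ε : ℝ) (ξ : Fin d → ℝ) : ℂ := cutoffProfile (ε⁻¹ • halfSine ξ)

theorem contDiff_cutoff (ε : ℝ) (N : ℕ) : ContDiff ℝ N (cutoff (d := d) ε) :=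
  (contDiff_cutoffProfile N).comp ((contDiff_halfSine _).const_smul ε⁻¹)

theorem torusPeriodic_cutoff (ε : ℝ) : TorusPeriodic (cutoff (d := d) ε) := by
  intro ξ i
  simp only [cutoff, cutoffProfile, Pi.smul_apply, smul_eq_mul, mul_pow, sq_halfSine_add_single]

theorem cutoff_eq_one (hε : 0 < ε) (h : ‖ξ‖ ≤ 3 / 4 * ε) : cutoff ε ξ = 1 := by
  refine cutoffProfile_eq_one fun l => ?_
  rw [Pi.smul_apply, smul_eq_mul, abs_mul, abs_inv, abs_of_pos hε, inv_mul_le_iff₀ hε, mul_comm ε]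
  exact (abs_halfSine_le ξ l).trans ((norm_le_pi_norm ξ l).trans h)

theorem cutoff_eventuallyEq_zero (hε : 0 < ε) (hε1 : ε < 1) (hξ : ε < ‖ξ‖) (hξπ : ‖ξ‖ ≤ π) :
    cutoff ε =ᶠ[𝓝 ξ] 0 := by
  obtain ⟨l, hl⟩ : ∃ l, ε < |ξ l| := by
    by_contra! h
    exact hξ.not_ge ((pi_norm_le_iff_of_nonneg hε.le).2 h)
  have hcont : Continuous fun η : Fin d → ℝ => |halfSine η l| :=
    ((continuous_apply l).comp (contDiff_halfSine 0).continuous).abs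
  filter_upwards [hcont.continuousAt.eventually
    (lt_mem_nhds (lt_abs_halfSine hε hε1 hl ((norm_le_pi_norm ξ l).trans hξπ)))] with η hη
  refine cutoffProfile_eq_zero (l := l) ?_
  rw [Pi.smul_apply, smul_eq_mul, abs_mul, abs_inv, abs_of_pos hε, le_inv_mul_iff₀ hε]
  linarith

theorem exists_derivBound_cutoff (N : ℕ) : ∃ C : ℝ, 1 ≤ C ∧ ∀ ε : ℝ, 0 < ε → ε < 1 →
    ∀ ξ : Fin d → ℝ, ‖ξ‖ ≤ π → DerivBound N (1 / ε) C (cutoff ε) ξ := by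
  obtain ⟨A, hA1, hA⟩ := exists_norm_iteratedFDeriv_le_of_isCompact
    (contDiff_halfSine (d := d) N) (isCompact_closedBall 0 π)
  obtain ⟨B, hB1, hB⟩ := exists_derivBound_of_hasCompactSupport
    (contDiff_cutoffProfile (d := d) N) hasCompactSupport_cutoffProfile
  have hfactorial : (1 : ℝ) ≤ N.factorial := by exact_mod_cast Nat.factorial_pos N
  refine ⟨A ^ N * (N.factorial * B), one_le_mul_of_one_le_of_one_le (one_le_pow₀ hA1)
    (one_le_mul_of_one_le_of_one_le hfactorial hB1), fun ε hε hε1 ξ hξ => ?_⟩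
  have hinv : 1 ≤ 1 / ε := one_le_one_div hε hε1.le
  refine ((hB _).comp (fun j hj1 hj => ?_) (contDiff_cutoffProfile N)
    ((contDiff_halfSine _).const_smul ε⁻¹) (a := A * (1 / ε)) (by positivity)).rescale hA1
    (by positivity) (by positivity)
  calc ‖iteratedFDeriv ℝ j (fun η : Fin d → ℝ => ε⁻¹ • halfSine η) ξ‖
      = 1 / ε * ‖iteratedFDeriv ℝ j halfSine ξ‖ := by
        rw [iteratedFDeriv_const_smul_apply' (contDiff_halfSine _).contDiffAt, norm_smul,
          Real.norm_eq_abs, abs_of_pos (by positivity), one_div]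
    _ ≤ 1 / ε * A := by gcongr; exact hA j hj ξ (mem_closedBall_zero_iff.2 hξ)
    _ = A * (1 / ε) := mul_comm _ _
    _ ≤ (A * (1 / ε)) ^ j :=
        le_self_pow₀ (one_le_mul_of_one_le_of_one_le hA1 hinv) (by omega)

end Cutoff

section Phase

variable {d k : ℕ} {Φ : (Fin d → ℝ) → ℂ} {M lam : ℝ}

/-- An exponent on the torus which vanishes at the origin and whose real part lies below
`-M |ξ|²` on the period cube `[-π,π]^d`. -/
structure IsDecayingExponent (M : ℝ) (Φ : (Fin d → ℝ) → ℂ) : Prop where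
  periodic : TorusPeriodic Φ
  zero : Φ 0 = 0
  re_le : ∀ ξ, ‖ξ‖ ≤ π → (Φ ξ).re ≤ -(M * ∑ i, ξ i ^ 2)

theorem IsDecayingExponent.re_fderiv_eq_zero (h : IsDecayingExponent M Φ) (hM : 0 ≤ M)
    (hΦ : Differentiable ℝ Φ) (v : Fin d → ℝ) : (fderiv ℝ Φ 0 v).re = 0 := by
  have hmax : IsLocalMax (fun ξ => (Φ ξ).re) 0 := by
    filter_upwards [Metric.closedBall_mem_nhds 0 Real.pi_pos] with ξ hξ
    rw [h.zero, Complex.zero_re]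
    exact (h.re_le ξ (mem_closedBall_zero_iff.1 hξ)).trans (neg_nonpos.2 (by positivity))
  exact DFunLike.congr_fun (hmax.hasFDerivAt_eq_zero
    (Complex.reCLM.hasFDerivAt.comp 0 (hΦ 0).hasFDerivAt)) v

/-- The exponent `lam Φ` with the integral frequency `n` removed. -/
def phase (Φ : (Fin d → ℝ) → ℂ) (lam : ℝ) (n : Fin d → ℤ) (ξ : Fin d → ℝ) : ℂ :=
  lam • Φ ξ - frequencyForm n ξ

theorem exp_phase (Φ : (Fin d → ℝ) → ℂ) (lam : ℝ) (n : Fin d → ℤ) (ξ : Fin d → ℝ) :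
    Complex.exp (phase Φ lam n ξ) = Complex.exp (lam * Φ ξ) * character (-n) ξ := by
  rw [phase, sub_eq_add_neg, Complex.exp_add, character_neg, frequencyForm_apply,
    Complex.real_smul]

theorem contDiff_phase {N : WithTop ℕ∞} (hΦ : ContDiff ℝ N Φ) (lam : ℝ) (n : Fin d → ℤ) :
    ContDiff ℝ N (phase Φ lam n) :=
  (hΦ.const_smul lam).sub (frequencyForm n).contDiff

theorem norm_iteratedFDeriv_phase {j : ℕ} (hΦ : ContDiff ℝ j Φ) (hj : 2 ≤ j) (hlam : 0 ≤ lam)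
    (n : Fin d → ℤ) (ξ : Fin d → ℝ) :
    ‖iteratedFDeriv ℝ j (phase Φ lam n) ξ‖ = lam * ‖iteratedFDeriv ℝ j Φ ξ‖ := by
  have hlinear : iteratedFDeriv ℝ j (frequencyForm n) ξ = 0 := by
    obtain ⟨i, rfl⟩ : ∃ i, j = i + 1 := ⟨j - 1, by omega⟩
    have hfderiv : fderiv ℝ (frequencyForm n) = fun _ => frequencyForm n :=
      funext fun x => (frequencyForm n).fderiv
    rw [← norm_eq_zero, ← norm_iteratedFDeriv_fderiv, hfderiv,
      iteratedFDeriv_const_of_ne (by omega), Pi.zero_apply, norm_zero]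
  have hphase : phase Φ lam n = (fun ξ => lam • Φ ξ) - frequencyForm n := rfl
  rw [hphase, iteratedFDeriv_sub_apply (hΦ.const_smul lam).contDiffAt
    (frequencyForm n).contDiff.contDiffAt, hlinear, sub_zero,
    iteratedFDeriv_const_smul_apply' hΦ.contDiffAt, norm_smul, Real.norm_of_nonneg hlam]

-- Rounding `lam ∇(Im Φ)(0)` to the nearest integral frequency leaves a phase that is stationary at
-- the origin up to an error bounded independently of `lam`.
theorem IsDecayingExponent.exists_norm_iteratedFDeriv_one_phase_le (h : IsDecayingExponent M Φ)
    (hM : 0 ≤ M) (hΦ : Differentiable ℝ Φ) (lam : ℝ) :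
    ∃ n : Fin d → ℤ, ‖iteratedFDeriv ℝ 1 (phase Φ lam n) 0‖ ≤ d := by
  let x (i : Fin d) : ℝ := lam * (fderiv ℝ Φ 0 (Pi.single i 1)).im
  have hfderiv (n : Fin d → ℤ) :
      fderiv ℝ (phase Φ lam n) 0 = lam • fderiv ℝ Φ 0 - frequencyForm n :=
    (((hΦ 0).hasFDerivAt.const_smul lam).sub (frequencyForm n).hasFDerivAt).fderiv
  have hcoord (i : Fin d) : fderiv ℝ (phase Φ lam fun i => round (x i)) 0 (Pi.single i 1) =
      Complex.I * ((x i - round (x i) : ℝ) : ℂ) := by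
    have him : fderiv ℝ Φ 0 (Pi.single i 1) =
        Complex.I * ((fderiv ℝ Φ 0 (Pi.single i 1)).im : ℂ) := by
      apply Complex.ext <;> simp [h.re_fderiv_eq_zero hM hΦ]
    rw [hfderiv, sub_apply, smul_apply, frequencyForm_single, him, Complex.real_smul]
    simp only [x]
    push_cast
    ring
  refine ⟨fun i => round (x i), (opNorm_le_of_apply_single_le _ zero_le_one fun s => ?_).trans_eq
    (by rw [pow_one, mul_one])⟩
  rw [iteratedFDeriv_one_apply, hcoord, norm_mul, Complex.norm_I, one_mul, Complex.norm_real]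
  exact (abs_sub_round _).trans (by norm_num)

theorem norm_iteratedFDeriv_one_phase_le (hΦ : ContDiff ℝ 2 Φ) {A R : ℝ}
    (hA : ∀ ξ ∈ Metric.closedBall 0 R, ‖iteratedFDeriv ℝ 2 Φ ξ‖ ≤ A) (hlam : 0 ≤ lam)
    (n : Fin d → ℤ) {ξ : Fin d → ℝ} (hξ : ‖ξ‖ ≤ R) :
    ‖iteratedFDeriv ℝ 1 (phase Φ lam n) ξ‖ ≤
      ‖iteratedFDeriv ℝ 1 (phase Φ lam n) 0‖ + lam * A * ‖ξ‖ := by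
  have hmean : ‖iteratedFDeriv ℝ 1 (phase Φ lam n) ξ - iteratedFDeriv ℝ 1 (phase Φ lam n) 0‖ ≤
      lam * A * ‖ξ - 0‖ := by
    refine (convex_closedBall 0 R).norm_image_sub_le_of_norm_fderiv_le (𝕜 := ℝ)
      (fun x _ => (contDiff_phase hΦ lam n).differentiable_iteratedFDeriv (m := 1)
        (by norm_cast) x)
      (fun x hx => ?_) (Metric.mem_closedBall_self ((norm_nonneg ξ).trans hξ))
      (mem_closedBall_zero_iff.2 hξ)
    rw [norm_fderiv_iteratedFDeriv, norm_iteratedFDeriv_phase hΦ le_rfl hlam]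
    gcongr
    exact hA x hx
  rw [sub_zero] at hmean
  linarith [norm_sub_norm_le (iteratedFDeriv ℝ 1 (phase Φ lam n) ξ)
    (iteratedFDeriv ℝ 1 (phase Φ lam n) 0)]

theorem norm_iteratedFDeriv_phase_le {N : ℕ} (hN : 2 ≤ N) (hΦ : ContDiff ℝ N Φ) {A R : ℝ}
    (hA1 : 1 ≤ A) (hA : ∀ j ≤ N, ∀ ξ ∈ Metric.closedBall 0 R, ‖iteratedFDeriv ℝ j Φ ξ‖ ≤ A)
    (hlam : 0 ≤ lam) {n : Fin d → ℤ} (hn : ‖iteratedFDeriv ℝ 1 (phase Φ lam n) 0‖ ≤ d)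
    {ξ : Fin d → ℝ} (hξ : ‖ξ‖ ≤ R) {j : ℕ} (hj1 : 1 ≤ j) (hjN : j ≤ N) :
    ‖iteratedFDeriv ℝ j (phase Φ lam n) ξ‖ ≤ ((A + d) * (1 + √lam) * (1 + √lam * ‖ξ‖)) ^ j := by
  have hsq : √lam ^ 2 = lam := Real.sq_sqrt hlam
  have hs := Real.sqrt_nonneg lam
  have hd : (0 : ℝ) ≤ d := Nat.cast_nonneg d
  rcases hj1.eq_or_lt with rfl | hj2
  · have htwo : (2 : WithTop ℕ∞) ≤ N := by exact_mod_cast hN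
    calc ‖iteratedFDeriv ℝ 1 (phase Φ lam n) ξ‖ ≤ d + lam * A * ‖ξ‖ :=
          (norm_iteratedFDeriv_one_phase_le (hΦ.of_le htwo) (hA 2 hN) hlam n hξ).trans
            (by gcongr)
      _ ≤ (A + d) * (1 + lam * ‖ξ‖) := by
          nlinarith [mul_nonneg (mul_nonneg hd hlam) (norm_nonneg ξ)]
      _ ≤ (A + d) * ((1 + √lam) * (1 + √lam * ‖ξ‖)) := by
          gcongr
          calc 1 + lam * ‖ξ‖ = 1 + √lam * (√lam * ‖ξ‖) := by rw [← mul_assoc, ← sq, hsq]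
            _ ≤ (1 + √lam) * (1 + √lam * ‖ξ‖) := by
                nlinarith [mul_nonneg hs (norm_nonneg ξ)]
      _ = _ := by rw [pow_one, mul_assoc]
  · have hbase : 1 ≤ (A + d) * (1 + √lam) :=
      one_le_mul_of_one_le_of_one_le (by linarith) (by linarith)
    have hjN' : (j : WithTop ℕ∞) ≤ N := by exact_mod_cast hjN
    calc ‖iteratedFDeriv ℝ j (phase Φ lam n) ξ‖ = lam * ‖iteratedFDeriv ℝ j Φ ξ‖ :=
          norm_iteratedFDeriv_phase (hΦ.of_le hjN') hj2 hlam n ξ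
      _ ≤ √lam ^ 2 * A := by
          rw [hsq]
          gcongr
          exact hA j hjN ξ (mem_closedBall_zero_iff.2 hξ)
      _ ≤ (1 + √lam) ^ 2 * (A + d) ^ 2 := by
          gcongr
          · linarith
          · nlinarith
      _ = ((A + d) * (1 + √lam)) ^ 2 := by ring
      _ ≤ ((A + d) * (1 + √lam)) ^ j := pow_le_pow_right₀ hbase hj2
      _ ≤ _ := by
          refine pow_le_pow_left₀ (by positivity) ?_ j
          exact le_mul_of_one_le_right (by positivity) (le_add_of_nonneg_right (by positivity))

theorem IsDecayingExponent.re_phase_le (h : IsDecayingExponent M Φ) (hlam : 0 ≤ lam)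
    (n : Fin d → ℤ) {ξ : Fin d → ℝ} (hξ : ‖ξ‖ ≤ π) :
    (phase Φ lam n ξ).re ≤ -(lam * M * ∑ i, ξ i ^ 2) := by
  rw [phase, Complex.sub_re, re_frequencyForm, sub_zero, Complex.real_smul, Complex.re_ofReal_mul]
  exact (mul_le_mul_of_nonneg_left (h.re_le ξ hξ) hlam).trans_eq (by ring)

theorem sq_pi_norm_le_sum_sq (ξ : Fin d → ℝ) : ‖ξ‖ ^ 2 ≤ ∑ i, ξ i ^ 2 := by
  have hnorm : ‖ξ‖ ≤ √(∑ i, ξ i ^ 2) := (pi_norm_le_iff_of_nonneg (Real.sqrt_nonneg _)).2 fun i =>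
    Real.abs_le_sqrt (Finset.single_le_sum (f := fun i => ξ i ^ 2) (fun _ _ => sq_nonneg _)
      (Finset.mem_univ i))
  rwa [Real.le_sqrt (norm_nonneg ξ) (by positivity)] at hnorm

theorem one_add_pow_mul_exp_neg_le {c t : ℝ} (hc : 0 < c) (ht : 0 ≤ t) {j : ℕ} (hjk : j ≤ k) :
    (1 + t) ^ j * Real.exp (-(c * t ^ 2)) ≤ Real.exp (k ^ 2 / (4 * c)) := by
  have hpow : (1 + t) ^ j ≤ Real.exp (k * t) :=
    calc (1 + t) ^ j ≤ (1 + t) ^ k := pow_le_pow_right₀ (by linarith) hjk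
      _ ≤ Real.exp t ^ k := by gcongr; linarith [Real.add_one_le_exp t]
      _ = Real.exp (k * t) := (Real.exp_nat_mul t k).symm
  have hsquare : (k : ℝ) ^ 2 / (4 * c) - (k * t - c * t ^ 2) = (2 * c * t - k) ^ 2 / (4 * c) := by
    field_simp
    ring
  have hnonneg : 0 ≤ (2 * c * t - k) ^ 2 / (4 * c) := by positivity
  calc (1 + t) ^ j * Real.exp (-(c * t ^ 2)) ≤ Real.exp (k * t) * Real.exp (-(c * t ^ 2)) := by
        gcongr
    _ ≤ Real.exp (k ^ 2 / (4 * c)) := by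
        rw [← Real.exp_add]
        exact Real.exp_le_exp.2 (by linarith)

theorem derivBound_cexp (N : ℕ) (z : ℂ) : DerivBound N 1 (Real.exp z.re) Complex.exp z := by
  intro j _
  have hscalars := ContDiffAt.restrictScalars_iteratedFDeriv (𝕜 := ℝ) (𝕜' := ℂ) (n := j)
    (Complex.contDiff_exp (n := (j : WithTop ℕ∞))).contDiffAt (x := z)
  rw [← hscalars, Function.comp_apply, ContinuousMultilinearMap.norm_restrictScalars,
    norm_iteratedFDeriv_eq_norm_iteratedDeriv, iteratedDeriv_eq_iterate, Complex.iter_deriv_exp,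
    Complex.norm_exp, one_pow, mul_one]

theorem IsDecayingExponent.exists_gaussianBound_exp_phase (h : IsDecayingExponent M Φ) (hM : 0 < M)
    (hΦ : ContDiff ℝ (max 2 k : ℕ) Φ) :
    ∃ C : ℝ, 0 < C ∧ ∀ lam : ℝ, 0 < lam → ∃ n : Fin d → ℤ,
      GaussianBound k (1 + √lam) C (8 / 9 * lam * M) fun ξ => Complex.exp (phase Φ lam n ξ) := by
  obtain ⟨A, hA1, hA⟩ := exists_norm_iteratedFDeriv_le_of_isCompact hΦ (isCompact_closedBall 0 π)
  have hAd : 1 ≤ A + d := le_add_of_le_of_nonneg hA1 (Nat.cast_nonneg d)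
  have hk : (k : WithTop ℕ∞) ≤ (max 2 k : ℕ) := by exact_mod_cast le_max_right 2 k
  refine ⟨k.factorial * (A + d) ^ k * Real.exp (k ^ 2 / (4 * (M / 9))), by positivity,
    fun lam hlam => ?_⟩
  obtain ⟨n, hn⟩ := h.exists_norm_iteratedFDeriv_one_phase_le hM.le
    (hΦ.differentiable (by norm_cast; omega)) lam
  refine ⟨n, fun ξ hξ j hj => ?_⟩
  have hre : (phase Φ lam n ξ).re ≤
      -(M / 9 * (√lam * ‖ξ‖) ^ 2) + -(8 / 9 * lam * M * ∑ i, ξ i ^ 2) := by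
    rw [mul_pow, Real.sq_sqrt hlam.le]
    nlinarith [h.re_phase_le hlam.le n hξ, mul_pos hlam hM, sq_pi_norm_le_sum_sq ξ]
  have hcomp := (derivBound_cexp k (phase Φ lam n ξ)).comp
    (fun i hi1 hi => norm_iteratedFDeriv_phase_le (le_max_left 2 k) hΦ hA1 hA hlam.le hn hξ hi1
      (hi.trans (le_max_right 2 k)))
    Complex.contDiff_exp ((contDiff_phase hΦ lam n).of_le hk) (by positivity) j hj
  calc ‖iteratedFDeriv ℝ j (fun ξ => Complex.exp (phase Φ lam n ξ)) ξ‖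
      ≤ k.factorial * Real.exp (phase Φ lam n ξ).re *
          ((A + d) * (1 + √lam) * (1 + √lam * ‖ξ‖)) ^ j := hcomp
    _ ≤ k.factorial * (Real.exp (-(M / 9 * (√lam * ‖ξ‖) ^ 2)) *
          Real.exp (-(8 / 9 * lam * M * ∑ i, ξ i ^ 2))) *
          ((A + d) * (1 + √lam) * (1 + √lam * ‖ξ‖)) ^ j := by
        gcongr
        rw [← Real.exp_add]
        exact Real.exp_le_exp.2 hre
    _ = k.factorial * (A + d) ^ j *
          ((1 + √lam * ‖ξ‖) ^ j * Real.exp (-(M / 9 * (√lam * ‖ξ‖) ^ 2))) *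
          (Real.exp (-(8 / 9 * lam * M * ∑ i, ξ i ^ 2)) * (1 + √lam) ^ j) := by
        rw [mul_pow ((A + d) * (1 + √lam)), mul_pow (A + (d : ℝ))]
        ring
    _ ≤ k.factorial * (A + d) ^ k * Real.exp (k ^ 2 / (4 * (M / 9))) *
          (Real.exp (-(8 / 9 * lam * M * ∑ i, ξ i ^ 2)) * (1 + √lam) ^ j) := by
        gcongr
        exact one_add_pow_mul_exp_neg_le (by positivity) (by positivity) hj
    _ = _ := by ring

end Phase

section Splitting

variable {d k r : ℕ} {f h : (Fin d → ℝ) → ℂ} {a B c ε κ : ℝ}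

theorem GaussianBound.one_sub_cutoff_mul (hf : GaussianBound k a B κ f) (hfc : ContDiff ℝ k f)
    (hcut : ∀ ξ : Fin d → ℝ, ‖ξ‖ ≤ π → DerivBound k a c (cutoff ε) ξ) (hε : 0 < ε)
    (ha : 0 ≤ a) (hB : 0 ≤ B) (hc : 0 ≤ c) (hκ : 0 ≤ κ) :
    GaussianBound k a (2 ^ k * ((1 + c) * B) * Real.exp (-(9 / 32 * κ * ε ^ 2))) (κ / 2)
      ((1 - cutoff ε) * f) := by
  intro ξ hξ
  rcases lt_or_ge ‖ξ‖ (3 / 4 * ε) with hin | hout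
  · refine derivBound_of_eventuallyEq_zero ?_ ha (by positivity)
    filter_upwards [continuous_norm.continuousAt.eventually (gt_mem_nhds hin)] with η hη
    simp [cutoff_eq_one hε hη.le]
  · have hone : DerivBound k a 1 (1 : (Fin d → ℝ) → ℂ) ξ :=
      norm_one (α := ℂ) ▸ derivBound_const ha (1 : ℂ)
    have hone' : ContDiff ℝ k (1 : (Fin d → ℝ) → ℂ) := contDiff_const
    refine ((hone.sub (hcut ξ hξ) hone' (contDiff_cutoff ε k)).mul (hf ξ hξ)
      (hone'.sub (contDiff_cutoff ε k)) hfc ha (by positivity) (by positivity)).mono ha le_rfl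
      (by positivity) ?_
    -- half of the Gaussian weight at distance `3 ε / 4` accounts for `9 / 32 = (3 / 4) ^ 2 / 2`
    have htail : Real.exp (-(κ * ∑ i, ξ i ^ 2)) ≤
        Real.exp (-(9 / 32 * κ * ε ^ 2)) * Real.exp (-(κ / 2 * ∑ i, ξ i ^ 2)) := by
      have hsq : (3 / 4 * ε) ^ 2 ≤ ∑ i, ξ i ^ 2 :=
        (pow_le_pow_left₀ (by positivity) hout 2).trans (sq_pi_norm_le_sum_sq ξ)
      rw [← Real.exp_add]
      exact Real.exp_le_exp.2 (by nlinarith [mul_le_mul_of_nonneg_left hsq hκ])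
    calc 2 ^ k * ((1 + c) * (B * Real.exp (-(κ * ∑ i, ξ i ^ 2))))
        = 2 ^ k * ((1 + c) * B) * Real.exp (-(κ * ∑ i, ξ i ^ 2)) := by ring
      _ ≤ 2 ^ k * ((1 + c) * B) *
            (Real.exp (-(9 / 32 * κ * ε ^ 2)) * Real.exp (-(κ / 2 * ∑ i, ξ i ^ 2))) := by gcongr
      _ = _ := by ring

theorem GaussianBound.cutoff_mul_mul (hf : GaussianBound k a B κ f) (hfc : ContDiff ℝ k f)
    (hcut : ∀ ξ : Fin d → ℝ, ‖ξ‖ ≤ π → DerivBound k a c (cutoff ε) ξ) (hh : VanishesToOrder r h)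
    (hk : k ≤ r + 1) (hε : 0 < ε) (hε1 : ε < 1) (ha : 1 / ε ≤ a) (hB : 0 ≤ B) (hc : 0 ≤ c) :
    GaussianBound k a (4 ^ k * (1 + d) ^ k * Real.exp d * c * B *
      (ε ^ (r + 1) * betaSup (r + 1) h ε)) κ (cutoff ε * f * h) := by
  have hβ := betaSup_nonneg (r + 1) h ε
  have ha0 : 0 ≤ a := (one_div_pos.2 hε).le.trans ha
  intro ξ hξ
  rcases le_or_gt ‖ξ‖ ε with hin | hout
  · have htaylor := (hh.derivBound_betaSup hk hε hin).mono (by positivity) ha (by positivity) le_rfl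
    refine (((hcut ξ hξ).mul (hf ξ hξ) (contDiff_cutoff ε k) hfc ha0 hc (by positivity)).mul
      htaylor ((contDiff_cutoff ε k).mul hfc) (hh.contDiff.of_le (by exact_mod_cast hk)) ha0
      (by positivity) (by positivity)).mono ha0 le_rfl (by positivity) (le_of_eq ?_)
    rw [show (4 : ℝ) = 2 * 2 by norm_num, mul_pow]
    ring
  · refine derivBound_of_eventuallyEq_zero ?_ ha0 (by positivity)
    filter_upwards [cutoff_eventuallyEq_zero hε hε1 hout hξ] with η hη
    simp [hη]

theorem exists_wienerNorm_one_sub_cutoff_mul_le (hk : d < 2 * k) :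
    ∃ C : ℝ, 0 < C ∧ ∀ (f : (Fin d → ℝ) → ℂ) (a B κ ε : ℝ), TorusPeriodic f → ContDiff ℝ k f →
      0 ≤ B → 0 < κ → GaussianBound k a B κ f → 0 < ε → ε < 1 → 1 / ε ≤ a →
      wienerNorm ((1 - cutoff ε) * f) ≤
        C * B * √((a / √κ) ^ d) * Real.exp (-(9 / 32 * κ * ε ^ 2)) := by
  obtain ⟨C, hC, hgauss⟩ := exists_wienerNorm_le_of_gaussianBound hk
  obtain ⟨c, hc1, hcutoff⟩ := exists_derivBound_cutoff (d := d) k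
  have hc0 : 0 ≤ c := zero_le_one.trans hc1
  refine ⟨C * (2 ^ k * (1 + c)) * √(√2 ^ d), by positivity,
    fun f a B κ ε hf hfc hB hκ hG hε hε1 ha => ?_⟩
  have ha1 : 1 ≤ a := ((one_le_div hε).2 hε1.le).trans ha
  have hper : TorusPeriodic ((1 - cutoff ε) * f) :=
    (TorusPeriodic.sub (fun _ _ => rfl) (torusPeriodic_cutoff ε)).mul hf
  have hratio : a / √(κ / 2) = √2 * (a / √κ) := by
    rw [Real.sqrt_div hκ.le, div_div_eq_mul_div, mul_comm a, mul_div_assoc]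
  refine (hgauss _ a _ (κ / 2) hper ((contDiff_const.sub (contDiff_cutoff ε k)).mul hfc) ha1
    (by positivity) (by positivity) (hG.one_sub_cutoff_mul hfc
      (fun ξ hξ => (hcutoff ε hε hε1 ξ hξ).mono (by positivity) ha hc0 le_rfl)
      hε (by positivity) hB hc0 hκ.le)).trans_eq ?_
  rw [hratio, mul_pow, Real.sqrt_mul (by positivity)]
  ring

theorem exists_wienerNorm_cutoff_mul_mul_le (hk : d < 2 * k) :
    ∃ C : ℝ, 0 < C ∧ ∀ (r : ℕ) (f h : (Fin d → ℝ) → ℂ) (a B κ ε : ℝ), k ≤ r + 1 →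
      TorusPeriodic f → ContDiff ℝ k f → 0 ≤ B → 0 < κ → GaussianBound k a B κ f →
      TorusPeriodic h → VanishesToOrder r h → 0 < ε → ε < 1 → 1 / ε ≤ a →
      wienerNorm (cutoff ε * f * h) ≤
        C * B * √((a / √κ) ^ d) * (ε ^ (r + 1) * betaSup (r + 1) h ε) := by
  obtain ⟨C, hC, hgauss⟩ := exists_wienerNorm_le_of_gaussianBound hk
  obtain ⟨c, hc1, hcutoff⟩ := exists_derivBound_cutoff (d := d) k
  have hc0 : 0 < c := zero_lt_one.trans_le hc1
  refine ⟨C * (4 ^ k * (1 + d) ^ k * Real.exp d * c), by positivity,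
    fun r f h a B κ ε hkr hf hfc hB hκ hG hper hh hε hε1 ha => ?_⟩
  have ha1 : 1 ≤ a := ((one_le_div hε).2 hε1.le).trans ha
  have hβ := betaSup_nonneg (r + 1) h ε
  have hhc : ContDiff ℝ k h := hh.contDiff.of_le (by exact_mod_cast hkr)
  exact (hgauss _ a _ κ (((torusPeriodic_cutoff ε).mul hf).mul hper)
    (((contDiff_cutoff ε k).mul hfc).mul hhc) ha1 (by positivity) hκ
    (hG.cutoff_mul_mul hfc
      (fun ξ hξ => (hcutoff ε hε hε1 ξ hξ).mono (by positivity) ha hc0.le le_rfl)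
      hh hkr hε hε1 ha hB hc0.le)).trans_eq (by ring)

theorem exists_wienerNorm_mul_le_of_vanishesToOrder (hk : d < 2 * k) :
    ∃ C : ℝ, 0 < C ∧ ∀ (r : ℕ) (f h : (Fin d → ℝ) → ℂ) (a B κ ε : ℝ), k ≤ r + 1 →
      TorusPeriodic f → ContDiff ℝ k f → 0 ≤ B → 0 < κ → GaussianBound k a B κ f →
      TorusPeriodic h → VanishesToOrder r h → 0 < ε → ε < 1 → 1 / ε ≤ a →
      wienerNorm (f * h) ≤ C * B * √((a / √κ) ^ d) *
        (wienerNorm h * Real.exp (-(9 / 32 * κ * ε ^ 2)) + ε ^ (r + 1) * betaSup (r + 1) h ε) := by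
  obtain ⟨C₁, hC₁, houter⟩ := exists_wienerNorm_one_sub_cutoff_mul_le hk
  obtain ⟨C₂, hC₂, hinner⟩ := exists_wienerNorm_cutoff_mul_mul_le hk
  refine ⟨C₁ + C₂, by positivity,
    fun r f h a B κ ε hkr hf hfc hB hκ hG hper hh hε hε1 ha => ?_⟩
  have hβ := betaSup_nonneg (r + 1) h ε
  have hN := wienerNorm_nonneg h
  have hhc : ContDiff ℝ k h := hh.contDiff.of_le (by exact_mod_cast hkr)
  have hmemh := memWiener_of_contDiff hk hper hhc
  have hmemout : MemWiener ((1 - cutoff ε) * f) := memWiener_of_contDiff hk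
    ((TorusPeriodic.sub (fun _ _ => rfl) (torusPeriodic_cutoff ε)).mul hf)
    ((contDiff_const.sub (contDiff_cutoff ε k)).mul hfc)
  calc wienerNorm (f * h) = wienerNorm (h * ((1 - cutoff ε) * f) + cutoff ε * f * h) := by
        congr 1; ring
    _ ≤ wienerNorm (h * ((1 - cutoff ε) * f)) + wienerNorm (cutoff ε * f * h) :=
        wienerNorm_add_le
          (memWiener_of_contDiff hk (hper.mul hmemout.periodic)
            (hhc.mul ((contDiff_const.sub (contDiff_cutoff ε k)).mul hfc)))
          (memWiener_of_contDiff hk (((torusPeriodic_cutoff ε).mul hf).mul hper)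
            (((contDiff_cutoff ε k).mul hfc).mul hhc))
    _ ≤ wienerNorm h * (C₁ * B * √((a / √κ) ^ d) * Real.exp (-(9 / 32 * κ * ε ^ 2))) +
          C₂ * B * √((a / √κ) ^ d) * (ε ^ (r + 1) * betaSup (r + 1) h ε) := by
        refine add_le_add ((wienerNorm_mul_le hmemh hmemout).trans ?_)
          (hinner r f h a B κ ε hkr hf hfc hB hκ hG hper hh hε hε1 ha)
        gcongr
        exact houter f a B κ ε hf hfc hB hκ hG hε hε1 ha
    _ = B * √((a / √κ) ^ d) * (C₁ * (wienerNorm h * Real.exp (-(9 / 32 * κ * ε ^ 2))) +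
          C₂ * (ε ^ (r + 1) * betaSup (r + 1) h ε)) := by ring
    _ ≤ B * √((a / √κ) ^ d) *
          ((C₁ + C₂) * (wienerNorm h * Real.exp (-(9 / 32 * κ * ε ^ 2))) +
          (C₁ + C₂) * (ε ^ (r + 1) * betaSup (r + 1) h ε)) := by gcongr <;> linarith
    _ = _ := by ring

end Splitting

section Approximation

variable {d k : ℕ} {Φ : (Fin d → ℝ) → ℂ} {M : ℝ}

theorem TorusPeriodic.exp_mul (h : TorusPeriodic Φ) (lam : ℝ) :
    TorusPeriodic fun ξ => Complex.exp (lam * Φ ξ) :=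
  fun ξ i => by simp only [h ξ i]

theorem contDiff_exp_mul (hΦ : ContDiff ℝ k Φ) (lam : ℝ) :
    ContDiff ℝ k fun ξ => Complex.exp (lam * Φ ξ) :=
  (contDiff_const.mul hΦ).cexp

theorem wienerNorm_exp_mul_eq_phase (Φ : (Fin d → ℝ) → ℂ) (lam : ℝ) (n : Fin d → ℤ)
    (h : (Fin d → ℝ) → ℂ) :
    wienerNorm ((fun ξ => Complex.exp (lam * Φ ξ)) * h) =
      wienerNorm ((fun ξ => Complex.exp (phase Φ lam n ξ)) * h) := by
  rw [← wienerNorm_mul_character _ (-n)]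
  congr 1
  ext ξ
  simp only [Pi.mul_apply, exp_phase]
  ring

theorem IsDecayingExponent.periodic_exp_phase (h : IsDecayingExponent M Φ) (lam : ℝ)
    (n : Fin d → ℤ) : TorusPeriodic fun ξ => Complex.exp (phase Φ lam n ξ) := by
  simp only [exp_phase]
  exact (h.periodic.exp_mul lam).mul (torusPeriodic_character (-n))

theorem sqrt_div_sqrt_mul_pow {x y c : ℝ} (hc : 0 ≤ c) :
    √((x / √(c * y)) ^ d) = √((1 / √c) ^ d) * √((x / √y) ^ d) := by
  rw [Real.sqrt_mul hc, div_mul_eq_div_div_swap, div_eq_mul_one_div _ √c, mul_comm, mul_pow,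
    Real.sqrt_mul (by positivity)]

theorem IsDecayingExponent.exists_wienerNorm_exp_le (hΦ : IsDecayingExponent M Φ) (hM : 0 < M)
    (hc : ContDiff ℝ (max 2 k : ℕ) Φ) (hk : d < 2 * k) {lam₀ : ℝ} (hlam₀ : 0 < lam₀) :
    ∃ C : ℝ, 0 < C ∧ ∀ lam : ℝ, lam₀ ≤ lam →
      wienerNorm (fun ξ => Complex.exp (lam * Φ ξ)) ≤ C := by
  obtain ⟨C, hC, hgauss⟩ := exists_wienerNorm_le_of_gaussianBound hk
  obtain ⟨B, hB, hphase⟩ := hΦ.exists_gaussianBound_exp_phase hM hc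
  refine ⟨C * B * (√((1 / √(8 / 9 * M)) ^ d) * √((1 / √lam₀ + 1) ^ d)), by positivity,
    fun lam hlam => ?_⟩
  have hlam0 : 0 < lam := hlam₀.trans_le hlam
  have hs : 0 < √lam := Real.sqrt_pos.2 hlam0
  obtain ⟨n, hn⟩ := hphase lam hlam0
  have hratio : (1 + √lam) / √lam ≤ 1 / √lam₀ + 1 := by
    rw [add_div, div_self hs.ne']
    gcongr
  have hck : ContDiff ℝ k Φ := hc.of_le (by exact_mod_cast le_max_right 2 k)
  calc wienerNorm (fun ξ => Complex.exp (lam * Φ ξ))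
      = wienerNorm fun ξ => Complex.exp (phase Φ lam n ξ) := by
        simpa using wienerNorm_exp_mul_eq_phase Φ lam n 1
    _ ≤ C * B * √(((1 + √lam) / √(8 / 9 * lam * M)) ^ d) :=
        hgauss _ _ B _ (hΦ.periodic_exp_phase lam n) (contDiff_phase hck lam n).cexp
          (by linarith) hB.le (by positivity) hn
    _ = C * B * (√((1 / √(8 / 9 * M)) ^ d) * √(((1 + √lam) / √lam) ^ d)) := by
        rw [mul_right_comm (8 / 9), sqrt_div_sqrt_mul_pow (by positivity)]
    _ ≤ _ := by gcongr

theorem IsDecayingExponent.exists_wienerNorm_exp_mul_le_split (hΦ : IsDecayingExponent M Φ)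
    (hM : 0 < M) (hc : ContDiff ℝ (max 2 k : ℕ) Φ) (hk : d < 2 * k) :
    ∃ C : ℝ, 0 < C ∧ ∀ (r : ℕ) (lam ε : ℝ) (h : (Fin d → ℝ) → ℂ), k ≤ r + 1 → 0 < lam →
      0 < ε → ε < 1 → TorusPeriodic h → VanishesToOrder r h →
      wienerNorm ((fun ξ => Complex.exp (lam * Φ ξ)) * h) ≤
        C * √(((√lam + 1 / ε) / √lam) ^ d) *
          (wienerNorm h * Real.exp (-(lam * M * ε ^ 2 / 4)) +
            ε ^ (r + 1) * betaSup (r + 1) h ε) := by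
  obtain ⟨C, hC, hsplit⟩ := exists_wienerNorm_mul_le_of_vanishesToOrder hk
  obtain ⟨B, hB, hphase⟩ := hΦ.exists_gaussianBound_exp_phase hM hc
  refine ⟨C * B * √((1 / √(8 / 9 * M)) ^ d), by positivity,
    fun r lam ε h hkr hlam hε hε1 hper hh => ?_⟩
  obtain ⟨n, hn⟩ := hphase lam hlam
  have hinv : 1 ≤ 1 / ε := (one_le_div hε).2 hε1.le
  have hs := Real.sqrt_nonneg lam
  have hck : ContDiff ℝ k Φ := hc.of_le (by exact_mod_cast le_max_right 2 k)
  rw [wienerNorm_exp_mul_eq_phase Φ lam n]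
  refine (hsplit r _ h (√lam + 1 / ε) B _ ε hkr (hΦ.periodic_exp_phase lam n)
    (contDiff_phase hck lam n).cexp hB.le (by positivity)
    (hn.mono (by positivity) (by linarith) hB.le) hper hh hε hε1 (by linarith)).trans_eq ?_
  have hrate : 9 / 32 * (8 / 9 * M * lam) * ε ^ 2 = lam * M * ε ^ 2 / 4 := by ring
  rw [mul_right_comm (8 / 9), hrate, sqrt_div_sqrt_mul_pow (by positivity)]
  ring

theorem sqrt_add_one_div_div_pow_le {lam ε : ℝ} (hε : 0 < ε) (hlam : 1 ≤ ε * √lam) :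
    √(((√lam + 1 / ε) / √lam) ^ d) ≤ √(2 ^ d) := by
  have hs : 0 < √lam := pos_of_mul_pos_right (one_pos.trans_le hlam) hε.le
  have hinv : 1 / ε ≤ √lam := (div_le_iff₀' hε).2 hlam
  gcongr
  rw [div_le_iff₀ hs]
  linarith

-- When `ε √lam ≤ 1` the exponential weight is bounded below, and no cutoff is needed.
theorem IsDecayingExponent.exists_wienerNorm_exp_mul_le (hΦ : IsDecayingExponent M Φ)
    (hM : 0 < M) (hc : ContDiff ℝ (max 2 k : ℕ) Φ) (hk : d < 2 * k) {lam₀ : ℝ}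
    (hlam₀ : 0 < lam₀) :
    ∃ C : ℝ, 0 < C ∧ ∀ (r : ℕ) (lam ε : ℝ) (h : (Fin d → ℝ) → ℂ), k ≤ r + 1 → lam₀ ≤ lam →
      0 < ε → ε < 1 → TorusPeriodic h → VanishesToOrder r h →
      wienerNorm ((fun ξ => Complex.exp (lam * Φ ξ)) * h) ≤
        C * (wienerNorm h * Real.exp (-(lam * M * ε ^ 2 / 4)) +
          ε ^ (r + 1) * betaSup (r + 1) h ε * √(((√lam + 1 / ε) / √lam) ^ d)) := by
  obtain ⟨C, hC, hsplit⟩ := hΦ.exists_wienerNorm_exp_mul_le_split hM hc hk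
  obtain ⟨D, hD, hexp⟩ := hΦ.exists_wienerNorm_exp_le hM hc hk hlam₀
  refine ⟨C * √(2 ^ d) + D * Real.exp (M / 4), by positivity,
    fun r lam ε h hkr hlam hε hε1 hper hh => ?_⟩
  have hlam0 : 0 < lam := hlam₀.trans_le hlam
  have hN := wienerNorm_nonneg h
  have hβ := betaSup_nonneg (r + 1) h ε
  have hck : ContDiff ℝ k Φ := hc.of_le (by exact_mod_cast le_max_right 2 k)
  rcases le_total (ε * √lam) 1 with hcase | hcase
  · have hweight : 1 ≤ Real.exp (M / 4) * Real.exp (-(lam * M * ε ^ 2 / 4)) := by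
      have hsq : (ε * √lam) ^ 2 ≤ 1 := pow_le_one₀ (by positivity) hcase
      rw [mul_pow, Real.sq_sqrt hlam0.le] at hsq
      rw [← Real.exp_add, Real.one_le_exp_iff]
      nlinarith
    calc wienerNorm ((fun ξ => Complex.exp (lam * Φ ξ)) * h) ≤ D * wienerNorm h :=
          (wienerNorm_mul_le (memWiener_of_contDiff hk (hΦ.periodic.exp_mul lam)
            (contDiff_exp_mul hck lam)) (memWiener_of_contDiff hk hper
            (hh.contDiff.of_le (by exact_mod_cast hkr)))).trans (by gcongr; exact hexp lam hlam)
      _ ≤ D * wienerNorm h * (Real.exp (M / 4) * Real.exp (-(lam * M * ε ^ 2 / 4))) :=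
          le_mul_of_one_le_right (by positivity) hweight
      _ = D * Real.exp (M / 4) * (wienerNorm h * Real.exp (-(lam * M * ε ^ 2 / 4))) := by ring
      _ ≤ _ := by
          refine mul_le_mul ?_ ?_ (by positivity) (by positivity)
          · exact le_add_of_nonneg_left (by positivity)
          · exact le_add_of_nonneg_right (by positivity)
  · have hroot := sqrt_add_one_div_div_pow_le (d := d) hε hcase
    have htwo : 1 ≤ √((2 : ℝ) ^ d) := Real.one_le_sqrt.2 (one_le_pow₀ one_le_two)
    calc wienerNorm ((fun ξ => Complex.exp (lam * Φ ξ)) * h)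
        ≤ C * (√(((√lam + 1 / ε) / √lam) ^ d) *
              (wienerNorm h * Real.exp (-(lam * M * ε ^ 2 / 4))) +
            1 * (ε ^ (r + 1) * betaSup (r + 1) h ε * √(((√lam + 1 / ε) / √lam) ^ d))) :=
          (hsplit r lam ε h hkr hlam0 hε hε1 hper hh).trans_eq (by ring)
      _ ≤ C * (√(2 ^ d) * (wienerNorm h * Real.exp (-(lam * M * ε ^ 2 / 4))) +
            √(2 ^ d) * (ε ^ (r + 1) * betaSup (r + 1) h ε *
              √(((√lam + 1 / ε) / √lam) ^ d))) := by gcongr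
      _ = C * √(2 ^ d) * (wienerNorm h * Real.exp (-(lam * M * ε ^ 2 / 4)) +
            ε ^ (r + 1) * betaSup (r + 1) h ε * √(((√lam + 1 / ε) / √lam) ^ d)) := by ring
      _ ≤ _ := by
          gcongr
          exact le_add_of_nonneg_right (by positivity)

end Approximation

section Rates

variable {d k : ℕ} {Φ : (Fin d → ℝ) → ℂ} {M : ℝ}

theorem sqrt_sqrt_pow {x : ℝ} (hx : 0 ≤ x) (d : ℕ) : √(√x ^ d) = x ^ ((d : ℝ) / 4) := by
  rw [Real.sqrt_eq_rpow x, ← Real.rpow_natCast, ← Real.rpow_mul hx, Real.sqrt_eq_rpow,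
    ← Real.rpow_mul hx]
  congr 1
  ring

theorem sqrt_pow_le_pow {a : ℝ} (ha : 1 ≤ a) (hk : d ≤ 2 * k) : √(a ^ d) ≤ a ^ k := by
  rw [Real.sqrt_le_iff, ← pow_mul, mul_comm k]
  exact ⟨by positivity, pow_le_pow_right₀ ha hk⟩

theorem IsDecayingExponent.exists_wienerNorm_exp_mul_le_pow (hΦ : IsDecayingExponent M Φ)
    (hM : 0 < M) (hc : ContDiff ℝ (max 2 k : ℕ) Φ) (hk : d < 2 * k) {lam₀ : ℝ}
    (hlam₀ : 0 < lam₀) :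
    ∃ C : ℝ, 0 < C ∧ ∀ (r : ℕ) (lam ε : ℝ) (h : (Fin d → ℝ) → ℂ), k ≤ r + 1 → lam₀ ≤ lam →
      0 < ε → ε < 1 → TorusPeriodic h → VanishesToOrder r h →
      wienerNorm ((fun ξ => Complex.exp (lam * Φ ξ)) * h) ≤
        C * (wienerNorm h * (lam ^ k * Real.exp (-(lam * M * ε ^ 2 / 4)) / ε) +
          ε ^ (r + 1) * betaSup (r + 1) h ε / lam ^ ((d : ℝ) / 4) * (√lam + 1 / ε) ^ k) := by
  obtain ⟨C, hC, hbound⟩ := hΦ.exists_wienerNorm_exp_mul_le hM hc hk hlam₀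
  refine ⟨C * (1 + (lam₀ ^ k)⁻¹), by positivity, fun r lam ε h hkr hlam hε hε1 hper hh => ?_⟩
  have hlam0 : 0 < lam := hlam₀.trans_le hlam
  have hN := wienerNorm_nonneg h
  have hβ := betaSup_nonneg (r + 1) h ε
  have hinv : 1 ≤ 1 / ε := (one_le_div hε).2 hε1.le
  have hpow : 1 ≤ (1 + (lam₀ ^ k)⁻¹) * (lam ^ k / ε) :=
    calc 1 ≤ (lam₀ ^ k)⁻¹ * lam ^ k * (1 / ε) := by
          refine one_le_mul_of_one_le_of_one_le ?_ hinv
          rw [le_inv_mul_iff₀ (by positivity), mul_one]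
          gcongr
      _ = (lam₀ ^ k)⁻¹ * (lam ^ k / ε) := by ring
      _ ≤ _ := by gcongr; linarith
  have hroot : √(((√lam + 1 / ε) / √lam) ^ d) ≤
      (1 + (lam₀ ^ k)⁻¹) * ((√lam + 1 / ε) ^ k / lam ^ ((d : ℝ) / 4)) :=
    calc √(((√lam + 1 / ε) / √lam) ^ d) = √((√lam + 1 / ε) ^ d) / lam ^ ((d : ℝ) / 4) := by
          rw [div_pow, Real.sqrt_div (by positivity), sqrt_sqrt_pow hlam0.le]
      _ ≤ (√lam + 1 / ε) ^ k / lam ^ ((d : ℝ) / 4) := by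
          gcongr
          exact sqrt_pow_le_pow (by linarith [Real.sqrt_nonneg lam]) hk.le
      _ ≤ _ := le_mul_of_one_le_left (by positivity)
          (le_add_of_nonneg_right (by positivity))
  calc wienerNorm ((fun ξ => Complex.exp (lam * Φ ξ)) * h)
      ≤ C * (wienerNorm h * (1 * Real.exp (-(lam * M * ε ^ 2 / 4))) +
          ε ^ (r + 1) * betaSup (r + 1) h ε * √(((√lam + 1 / ε) / √lam) ^ d)) := by
        rw [one_mul]
        exact hbound r lam ε h hkr hlam hε hε1 hper hh
    _ ≤ C * (wienerNorm h * ((1 + (lam₀ ^ k)⁻¹) * (lam ^ k / ε) *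
            Real.exp (-(lam * M * ε ^ 2 / 4))) +
          ε ^ (r + 1) * betaSup (r + 1) h ε *
            ((1 + (lam₀ ^ k)⁻¹) * ((√lam + 1 / ε) ^ k / lam ^ ((d : ℝ) / 4)))) := by gcongr
    _ = _ := by ring

theorem eventually_mul_log_div_sqrt_lt {c ε : ℝ} (hε : 0 < ε) :
    ∀ᶠ x : ℝ in atTop, c * Real.log x / √x < ε := by
  have hlim : Tendsto (fun x : ℝ => c * (Real.log x / x ^ (1 / 2 : ℝ))) atTop (𝓝 (c * 0)) :=
    ((isLittleO_log_rpow_atTop one_half_pos).tendsto_div_nhds_zero).const_mul c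
  rw [mul_zero] at hlim
  filter_upwards [hlim.eventually (gt_mem_nhds hε)] with x hx
  rwa [Real.sqrt_eq_rpow, mul_div_assoc]

theorem exp_neg_mul_sq_log_div_sqrt_le {c p x : ℝ} (hM : 0 ≤ M) (hc : 1 ≤ c) (hx : 0 < x)
    (hlog : 1 ≤ Real.log x) (hp : p ≤ M * c / 4) :
    Real.exp (-(x * M * (c * Real.log x / √x) ^ 2 / 4)) ≤ (x ^ p)⁻¹ := by
  have hexponent : x * M * (c * Real.log x / √x) ^ 2 / 4 = M * c / 4 * (c * Real.log x ^ 2) := by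
    rw [div_pow, Real.sq_sqrt hx.le]
    field_simp
  rw [← Real.rpow_neg hx.le, Real.rpow_def_of_pos hx, hexponent, mul_neg]
  refine Real.exp_le_exp.2 (neg_le_neg ?_)
  calc Real.log x * p ≤ Real.log x * (M * c / 4) := by gcongr
    _ = M * c / 4 * (1 * (1 * Real.log x)) := by ring
    _ ≤ M * c / 4 * (c * (Real.log x * Real.log x)) := by gcongr
    _ = _ := by rw [sq]

theorem inv_rpow_le_pow_mul_log_pow_div {c p x : ℝ} (hc : 1 ≤ c) (hx : 0 < x)
    (hlog : 1 ≤ Real.log x) (r : ℕ) :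
    (x ^ p)⁻¹ ≤ c ^ (r + 1) * (Real.log x ^ (r + 1) / x ^ p) := by
  rw [← mul_div_assoc, div_eq_mul_inv]
  exact le_mul_of_one_le_left (by positivity)
    (one_le_mul_of_one_le_of_one_le (one_le_pow₀ hc) (one_le_pow₀ hlog))

theorem pow_mul_log_div_sqrt_le {c x : ℝ} (hc : 0 ≤ c) (hx : 1 ≤ x) (r : ℕ) :
    (c * Real.log x / √x) ^ (r + 1) ≤
      c ^ (r + 1) * (Real.log x ^ (r + 1) / x ^ ((r : ℝ) / 2 + 1 / 4)) := by
  have hlog := Real.log_nonneg hx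
  have hpow : x ^ ((r : ℝ) / 2 + 1 / 4) ≤ √x ^ (r + 1) := by
    rw [Real.sqrt_eq_rpow, ← Real.rpow_natCast, ← Real.rpow_mul (by positivity)]
    refine Real.rpow_le_rpow_of_exponent_le hx ?_
    push_cast
    linarith
  rw [div_pow, mul_pow, ← mul_div_assoc]
  gcongr

-- The scale `ε = c log λ / √λ` makes the Gaussian tail `exp (-λ M ε² / 4)` smaller than the Taylor
-- term as soon as `M c / 4 ≥ r / 2 + 1 / 4`.
theorem IsDecayingExponent.exists_wienerNorm_exp_mul_le_log (hΦ : IsDecayingExponent M Φ)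
    (hM : 0 < M) (hc : ContDiff ℝ (max 2 k : ℕ) Φ) (hk : d < 2 * k) {r : ℕ} (hkr : k ≤ r + 1) :
    ∃ C : ℝ, 0 < C ∧ ∀ ε : ℝ, 0 < ε → ∃ lam₁ : ℝ, 2 ≤ lam₁ ∧
      ∀ (lam : ℝ) (h : (Fin d → ℝ) → ℂ), lam₁ ≤ lam → TorusPeriodic h → VanishesToOrder r h →
      wienerNorm ((fun ξ => Complex.exp (lam * Φ ξ)) * h) ≤
        C * (wienerNorm h + betaSup (r + 1) h ε) *
          (Real.log lam ^ (r + 1) / lam ^ ((r : ℝ) / 2 + 1 / 4)) := by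
  obtain ⟨C, hC, hsplit⟩ := hΦ.exists_wienerNorm_exp_mul_le_split hM hc hk
  set c : ℝ := 1 + (2 * r + 1) / M
  have hc1 : 1 ≤ c := le_add_of_nonneg_right (by positivity)
  have hcM : (r : ℝ) / 2 + 1 / 4 ≤ M * c / 4 := by
    have hMc : M * c = M + (2 * r + 1) := by simp only [c]; field_simp
    linarith
  refine ⟨C * √(2 ^ d) * c ^ (r + 1), by positivity, fun ε hε => ?_⟩
  obtain ⟨x₀, hx₀⟩ := eventually_atTop.1 ((Real.tendsto_log_atTop.eventually_ge_atTop 1).and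
    (eventually_mul_log_div_sqrt_lt (c := c) (lt_min one_pos hε)))
  refine ⟨max 2 x₀, le_max_left _ _, fun lam h hlam hper hh => ?_⟩
  obtain ⟨hlog, hsmall⟩ := hx₀ lam ((le_max_right _ _).trans hlam)
  have hlam1 : 1 ≤ lam := one_le_two.trans ((le_max_left _ _).trans hlam)
  have hlam0 : 0 < lam := one_pos.trans_le hlam1
  set δ := c * Real.log lam / √lam with hδ
  set R := Real.log lam ^ (r + 1) / lam ^ ((r : ℝ) / 2 + 1 / 4)
  have hδ0 : 0 < δ := by positivity
  have hN := wienerNorm_nonneg h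
  have hβ := betaSup_nonneg (r + 1) h δ
  have hscale : 1 ≤ δ * √lam := by
    rw [hδ, div_mul_cancel₀ _ (Real.sqrt_pos.2 hlam0).ne']
    exact one_le_mul_of_one_le_of_one_le hc1 hlog
  have htail : Real.exp (-(lam * M * δ ^ 2 / 4)) ≤ c ^ (r + 1) * R :=
    (exp_neg_mul_sq_log_div_sqrt_le hM.le hc1 hlam0 hlog hcM).trans
      (inv_rpow_le_pow_mul_log_pow_div hc1 hlam0 hlog r)
  have hpow : δ ^ (r + 1) ≤ c ^ (r + 1) * R :=
    pow_mul_log_div_sqrt_le (zero_le_one.trans hc1) hlam1 r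
  have hroot := sqrt_add_one_div_div_pow_le (d := d) hδ0 hscale
  have hβmono : betaSup (r + 1) h δ ≤ betaSup (r + 1) h ε :=
    betaSup_mono hh.contDiff (hsmall.le.trans (min_le_right _ _))
  calc wienerNorm ((fun ξ => Complex.exp (lam * Φ ξ)) * h)
      ≤ C * √(((√lam + 1 / δ) / √lam) ^ d) * (wienerNorm h * Real.exp (-(lam * M * δ ^ 2 / 4)) +
          δ ^ (r + 1) * betaSup (r + 1) h δ) :=
        hsplit r lam δ h hkr hlam0 hδ0 (hsmall.trans_le (min_le_left _ _)) hper hh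
    _ ≤ C * √(2 ^ d) * (wienerNorm h * (c ^ (r + 1) * R) +
          c ^ (r + 1) * R * betaSup (r + 1) h ε) := by gcongr
    _ = _ := by ring

end Rates

section Scheme

variable {d r : ℕ} {φ : Fin d → ℝ → ℂ} {lam : ℝ} {μ ν : SignedMeasure (Fin d → ℤ)}
  {ψ χ : (Fin d → ℝ) → ℂ}

theorem contDiff_sumExponent {N : WithTop ℕ∞} (hφ : ∀ i, ContDiff ℝ N (φ i)) :
    ContDiff ℝ N (sumExponent φ) :=
  ContDiff.sum fun i _ => (hφ i).comp (contDiff_apply ℝ ℝ i)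

theorem torusPeriodic_sumExponent (hφ : ∀ i, Function.Periodic (φ i) (2 * π)) :
    TorusPeriodic (sumExponent φ) := by
  intro ξ i
  refine Finset.sum_congr rfl fun l _ => ?_
  rcases eq_or_ne l i with rfl | hl
  · rw [Pi.add_apply, Pi.single_eq_same, hφ l]
  · rw [Pi.add_apply, Pi.single_eq_of_ne hl, add_zero]

theorem isDecayingExponent_sumExponent {ρ : Fin d → Measure ℤ}
    (hprob : ∀ i, IsProbabilityMeasure (ρ i)) (hφ : ∀ i, IsLevyExponent (ρ i) (φ i)) :
    IsDecayingExponent (decayM φ) (sumExponent φ) where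
  periodic := torusPeriodic_sumExponent fun i => (hφ i).periodic
  zero := Finset.sum_eq_zero fun i _ => (hφ i).zero
  re_le ξ hξ := by
    rw [sumExponent, Complex.re_sum, Finset.mul_sum, ← Finset.sum_neg_distrib]
    exact Finset.sum_le_sum fun i _ => re_le_decayM hprob hφ i ((norm_le_pi_norm ξ i).trans hξ)

namespace ResidueScheme

theorem torusPeriodic_sub (h : ResidueScheme φ r lam μ ν ψ χ) : TorusPeriodic (ψ - χ) :=
  h.periodic_left.sub h.periodic_right

theorem vanishesToOrder_sub (h : ResidueScheme φ r lam μ ν ψ χ) : VanishesToOrder r (ψ - χ) where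
  contDiff := h.contDiff_left.sub h.contDiff_right
  iteratedFDeriv_eq_zero n hn := iteratedFDeriv_eq_zero_of_partialDeriv_eq_zero (h.taylor n hn)

theorem fourier_sub (h : ResidueScheme φ r lam μ ν ψ χ) :
    fourier μ - fourier ν = (fun ξ => Complex.exp (lam * sumExponent φ ξ)) * (ψ - χ) := by
  ext ξ
  simp only [Pi.sub_apply, Pi.mul_apply, h.fourier_left, h.fourier_right]
  ring

theorem memWiener_sub (h : ResidueScheme φ r lam μ ν ψ χ) (hr : d / 2 ≤ r) :
    MemWiener (ψ - χ) :=
  memWiener_of_contDiff (by omega) h.torusPeriodic_sub h.vanishesToOrder_sub.contDiff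

theorem memWiener_fourier_sub (h : ResidueScheme φ r lam μ ν ψ χ)
    (hper : ∀ i, Function.Periodic (φ i) (2 * π)) {k : ℕ} (hφ : ∀ i, ContDiff ℝ k (φ i))
    (hk : d < 2 * k) (hkr : k ≤ r + 1) : MemWiener (fourier μ - fourier ν) := by
  rw [h.fourier_sub]
  exact memWiener_of_contDiff hk
    (((torusPeriodic_sumExponent hper).exp_mul lam).mul h.torusPeriodic_sub)
    ((contDiff_exp_mul (contDiff_sumExponent hφ) lam).mul
      (h.vanishesToOrder_sub.contDiff.of_le (mod_cast hkr)))

end ResidueScheme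

end Scheme

end MultiWiener

end

open MultiWiener in
theorem theorem5_general (d : ℕ) (hd : 1 ≤ d)
    (ρ : Fin d → Measure ℤ)
    (hprob : ∀ i, IsProbabilityMeasure (ρ i))
    (φ : Fin d → ℝ → ℂ)
    (hφ : ∀ i, IsLevyExponent (ρ i) (φ i))
    (hlattice : ∀ i, HasMinimalLattice (ρ i))
    (hmoment : ∀ i, HasMoment (max 2 (K d)) (ρ i)) :
    (∀ lam₀ : ℝ, 0 < lam₀ → ∃ C₁ C₂ : ℝ, 0 < C₁ ∧ 0 < C₂ ∧
      ∀ (r : ℕ) (lam ε : ℝ) (μ ν : SignedMeasure (Fin d → ℤ))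
        (ψ χ : (Fin d → ℝ) → ℂ),
        d / 2 ≤ r → lam₀ ≤ lam → 0 < ε → ε < 1 →
        ResidueScheme φ r lam μ ν ψ χ →
        MemWiener (ψ - χ) ∧
        MemWiener (fourier μ - fourier ν) ∧
        wienerNorm (fourier μ - fourier ν) ≤
          C₁ * (wienerNorm (ψ - χ) *
                (lam ^ K d *
                  Real.exp (-(lam * decayM φ * ε ^ 2 / 4)) / ε)
              + ε ^ (r + 1) * betaSup (r + 1) (ψ - χ) ε / lam ^ ((d : ℝ) / 4) *
                (Real.sqrt lam + 1 / ε) ^ K d)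
            * (1 + C₂ / Real.sqrt lam)) ∧
    (∀ r : ℕ, d / 2 ≤ r → ∃ C₃ : ℝ, 0 < C₃ ∧
      ∀ ε : ℝ, 0 < ε → ∃ lam₁ : ℝ, 2 ≤ lam₁ ∧
        ∀ (lam : ℝ) (μ ν : SignedMeasure (Fin d → ℤ))
          (ψ χ : (Fin d → ℝ) → ℂ),
          lam₁ ≤ lam →
          ResidueScheme φ r lam μ ν ψ χ →
          MemWiener (ψ - χ) ∧
          MemWiener (fourier μ - fourier ν) ∧
          wienerNorm (fourier μ - fourier ν) ≤
            C₃ * (wienerNorm (ψ - χ) + betaSup (r + 1) (ψ - χ) ε) *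
              (Real.log lam ^ (r + 1) / lam ^ ((r : ℝ) / 2 + 1 / 4))) := by
  have hM := decayM_pos hd hprob hφ hlattice
  have hΦ := isDecayingExponent_sumExponent hprob hφ
  have hcont : ∀ i, ContDiff ℝ (max 2 (K d) : ℕ) (φ i) := fun i => (hφ i).contDiff (hmoment i)
  have hK : d < 2 * K d := by unfold K; omega
  have hmem : ∀ {r lam μ ν ψ χ}, d / 2 ≤ r → ResidueScheme φ r lam μ ν ψ χ →
      MemWiener (ψ - χ) ∧ MemWiener (fourier μ - fourier ν) := fun hr h =>
    ⟨h.memWiener_sub hr, h.memWiener_fourier_sub (fun i => (hφ i).periodic)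
      (fun i => (hcont i).of_le (mod_cast le_max_right 2 (K d))) hK (Nat.succ_le_succ hr)⟩
  refine ⟨fun lam₀ hlam₀ => ?_, fun r hr => ?_⟩
  · obtain ⟨C, hC, hbound⟩ :=
      hΦ.exists_wienerNorm_exp_mul_le_pow hM (contDiff_sumExponent hcont) hK hlam₀
    refine ⟨C, 1, hC, one_pos, fun r lam ε μ ν ψ χ hr hlam hε hε1 h =>
      ⟨(hmem hr h).1, (hmem hr h).2, ?_⟩⟩
    have hlam0 : 0 < lam := hlam₀.trans_le hlam
    have hN := wienerNorm_nonneg (ψ - χ)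
    have hβ := betaSup_nonneg (r + 1) (ψ - χ) ε
    rw [h.fourier_sub]
    exact (hbound r lam ε (ψ - χ) (Nat.succ_le_succ hr) hlam hε hε1 h.torusPeriodic_sub
      h.vanishesToOrder_sub).trans (le_mul_of_one_le_right (by positivity)
        (le_add_of_nonneg_right (by positivity)))
  · obtain ⟨C, hC, hbound⟩ := hΦ.exists_wienerNorm_exp_mul_le_log hM
      (contDiff_sumExponent hcont) hK (Nat.succ_le_succ hr)
    refine ⟨C, hC, fun ε hε => ?_⟩
    obtain ⟨lam₁, hlam₁, hbound⟩ := hbound ε hε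
    refine ⟨lam₁, hlam₁, fun lam μ ν ψ χ hlam h => ⟨(hmem hr h).1, (hmem hr h).2, ?_⟩⟩
    rw [h.fourier_sub]
    exact hbound lam (ψ - χ) hlam h.torusPeriodic_sub h.vanishesToOrder_sub

theorem theorem5 (d : ℕ) (hd : 1 ≤ d)
    (ρ : Fin d → MeasureTheory.Measure ℤ)
    (hprob : ∀ i, MeasureTheory.IsProbabilityMeasure (ρ i))
    (φ : Fin d → ℝ → ℂ)
    (hφ : ∀ i, MultiWiener.IsLevyExponent (ρ i) (φ i))
    (hlattice : ∀ i, MultiWiener.HasMinimalLattice (ρ i))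
    (hmoment : ∀ i, MultiWiener.HasMoment (max 2 (MultiWiener.K d)) (ρ i)) :
    (∀ lam₀ : ℝ, 0 < lam₀ → ∃ C₁ C₂ : ℝ, 0 < C₁ ∧ 0 < C₂ ∧
      ∀ (r : ℕ) (lam ε : ℝ) (μ ν : MeasureTheory.SignedMeasure (Fin d → ℤ))
        (ψ χ : (Fin d → ℝ) → ℂ),
        d / 2 ≤ r → lam₀ ≤ lam → 0 < ε → ε < 1 →
        (∀ i, MultiWiener.gammaSup φ ε ≤ MultiWiener.sigmaSq (φ i) / 2) →
        MultiWiener.ResidueScheme φ r lam μ ν ψ χ →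
        MultiWiener.MemWiener (ψ - χ) ∧
        MultiWiener.MemWiener (MultiWiener.fourier μ - MultiWiener.fourier ν) ∧
        MultiWiener.wienerNorm (MultiWiener.fourier μ - MultiWiener.fourier ν) ≤
          C₁ * (MultiWiener.wienerNorm (ψ - χ) *
                (lam ^ MultiWiener.K d *
                  Real.exp (-(lam * MultiWiener.decayM φ * ε ^ 2 / 4)) / ε)
              + ε ^ (r + 1) * MultiWiener.betaSup (r + 1) (ψ - χ) ε / lam ^ ((d : ℝ) / 4) *
                (Real.sqrt lam + 1 / ε) ^ MultiWiener.K d)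
            * (1 + C₂ / Real.sqrt lam)) ∧
    (∀ r : ℕ, d / 2 ≤ r → ∃ C₃ : ℝ, 0 < C₃ ∧
      ∀ ε : ℝ, 0 < ε → ∃ lam₁ : ℝ, 2 ≤ lam₁ ∧
        ∀ (lam : ℝ) (μ ν : MeasureTheory.SignedMeasure (Fin d → ℤ))
          (ψ χ : (Fin d → ℝ) → ℂ),
          lam₁ ≤ lam →
          MultiWiener.ResidueScheme φ r lam μ ν ψ χ →
          MultiWiener.MemWiener (ψ - χ) ∧
          MultiWiener.MemWiener (MultiWiener.fourier μ - MultiWiener.fourier ν) ∧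
          MultiWiener.wienerNorm (MultiWiener.fourier μ - MultiWiener.fourier ν) ≤
            C₃ * (MultiWiener.wienerNorm (ψ - χ) + MultiWiener.betaSup (r + 1) (ψ - χ) ε) *
              (Real.log lam ^ (r + 1) / lam ^ ((r : ℝ) / 2 + 1 / 4))) := by
  obtain ⟨hpow, hlog⟩ := theorem5_general d hd ρ hprob φ hφ hlattice hmoment
  exact ⟨fun lam₀ hlam₀ => (hpow lam₀ hlam₀).imp fun _ => Exists.imp fun _ h =>
    ⟨h.1, h.2.1, fun r lam ε μ ν ψ χ hr hlam hε hε1 _ => h.2.2 r lam ε μ ν ψ χ hr hlam hε hε1⟩,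
    hlog⟩
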